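/- **Theorem 2 (Joint convexity).** Let $\mathcal H$ be a complex Hilbert space, not necessarily finite-dimensional. For $1/2\le\alpha\le 1$ and bounded non-negative operators $\rho,\sigma$ on $\mathcal H$ with $0<\operatorname{tr}\rho<\infty$ (and, if $\alpha=1$, also $\operatorname{tr}\sigma<\infty$) let $$ D_\alpha(\rho\|\sigma)= \begin{cases} (\alpha-1)^{-1}\log\Bigl((\operatorname{tr}\rho)^{-1}\operatorname{tr}\bigl(\sigma^{(1-\alpha)/(2\alpha)}\,\rho\,\sigma^{(1-\alpha)/(2\alpha)}\bigr)^{\alpha}\Bigr) & \text{if } \tfrac12\le\alpha<1,\\[2pt] (\operatorname{tr}\rho)^{-1}\operatorname{tr}\rho\,(\log\rho-\log\sigma) & \text{if } \alpha=1, \end{cases} $$ with values in $[-\infty,\infty]$, where $\log 0=-\infty$ and $\log\infty=\infty$. For $\alpha=1$ the trace is understood through the spectral decompositions $\rho=\sum_\lambda\lambda P_\lambda$, $\sigma=\sum_\mu\mu Q_\mu$ as $\sum_{\lambda,\mu}\lambda(\log\lambda-\log\mu)\operatorname{tr}(P_\lambda Q_\mu)\in(-\infty,\infty]$, where terms with $\lambda=0$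 vanish; it equals $\infty$ if the kernel of $\sigma$ is not contained in the kernel of $\rho$. Let $1/2\le\alpha\le1$ and $t>0$. Then $D_\alpha(\rho\|\sigma)$ is jointly convex on the pairs $(\rho,\sigma)$ of such operators with $\operatorname{tr}\rho=t$: if $\operatorname{tr}\rho_1=\operatorname{tr}\rho_2=t$, $a,b\ge0$ and $a+b=1$, then $$ D_\alpha(a\rho_1+b\rho_2\,\|\,a\sigma_1+b\sigma_2)\le a\,D_\alpha(\rho_1\|\sigma_1)+b\,D_\alpha(\rho_2\|\sigma_2), $$ with the conventions $0\cdot(\pm\infty)=0$ and $\infty+(-\infty)=-\infty$ on the right-hand side (the value $-\infty$ can occur only if $\operatorname{tr}\sigma=\infty$). -/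

import Mathlib

open scoped NNReal ENNReal

noncomputable section

namespace RenyiDivergence

variable {H : Type*} [NormedAddCommGroup H] [InnerProductSpace ℂ H]

/-- Parseval's identity, with values in `[0, ∞]`. -/
theorem tsum_ofReal_norm_sq {ι : Type*} (b : HilbertBasis ι ℂ H) (x : H) :
    ∑' i, ENNReal.ofReal (‖inner ℂ (b i) x‖ ^ 2) = ENNReal.ofReal (‖x‖ ^ 2) := by
  have h := b.hasSum_inner_mul_inner x x
  have h2 : HasSum (fun i => ‖inner ℂ (b i) x‖ ^ 2) (‖x‖ ^ 2) := by
    have h3 := Complex.hasSum_re h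
    convert h3 using 1
    · funext i
      rw [← inner_conj_symm x (b i), ← Complex.normSq_eq_conj_mul_self, Complex.ofReal_re,
        Complex.normSq_eq_norm_sq]
    · exact (inner_self_eq_norm_sq (𝕜 := ℂ) x).symm
  rw [← h2.tsum_eq, ENNReal.ofReal_tsum_of_nonneg (fun i => by positivity) h2.summable]

variable [CompleteSpace H]

variable (H) in
/-- The index set of some Hilbert basis (complete orthonormal system) of `H`. -/
def basisIndex : Set H := (exists_hilbertBasis ℂ H).choose

variable (H) in
/-- Some Hilbert basis (complete orthonormal system) of `H`. -/
def basis : HilbertBasis (basisIndex H) ℂ H := (exists_hilbertBasis ℂ H).choose_spec.choose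

/-- The trace `∑ i, ⟨e i, A (e i)⟩ ∈ [0, ∞]` of a bounded non-negative operator `A`.
By `trace_eq_tsum` it does not depend on the Hilbert basis `e`. -/
def trace (A : H →L[ℂ] H) : ℝ≥0∞ :=
  ∑' i, ENNReal.ofReal (inner ℂ (basis H i) (A (basis H i))).re

/-- The trace of a non-negative operator can be computed in every Hilbert basis. -/
theorem trace_eq_tsum {ι : Type*} (b : HilbertBasis ι ℂ H) {A : H →L[ℂ] H} (hA : 0 ≤ A) :
    trace A = ∑' i, ENNReal.ofReal (inner ℂ (b i) (A (b i))).re := by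
  set B : H →L[ℂ] H := CFC.sqrt A with hB
  have hB0 : IsSelfAdjoint B := IsSelfAdjoint.of_nonneg (CFC.sqrt_nonneg A)
  have hBs : ∀ x y : H, inner ℂ (B x) y = inner ℂ x (B y) := fun x y => by
    conv_lhs => rw [← hB0.adjoint_eq]
    exact ContinuousLinearMap.adjoint_inner_left B y x
  have hBB : B * B = A := CFC.sqrt_mul_sqrt_self A hA
  have key : ∀ x : H, (inner ℂ x (A x)).re = ‖B x‖ ^ 2 := fun x => by
    rw [← hBB, mul_apply_eq_comp, ← hBs]
    exact inner_self_eq_norm_sq (𝕜 := ℂ) (B x)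
  simp only [trace, key]
  calc ∑' i, ENNReal.ofReal (‖B (basis H i)‖ ^ 2)
      = ∑' i, ∑' j, ENNReal.ofReal (‖inner ℂ (b j) (B (basis H i))‖ ^ 2) := by
        simp only [tsum_ofReal_norm_sq]
    _ = ∑' j, ∑' i, ENNReal.ofReal (‖inner ℂ (b j) (B (basis H i))‖ ^ 2) := ENNReal.tsum_comm
    _ = ∑' j, ∑' i, ENNReal.ofReal (‖inner ℂ (basis H i) (B (b j))‖ ^ 2) := by
        refine tsum_congr fun j => tsum_congr fun i => ?_
        rw [← hBs, norm_inner_symm]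
    _ = ∑' j, ENNReal.ofReal (‖B (b j)‖ ^ 2) := by simp only [tsum_ofReal_norm_sq]

/-- The orthogonal projection onto the eigenspace `ker (A - lam)`
(it is zero if `lam` is not an eigenvalue of `A`). -/
def eigenProj (A : H →L[ℂ] H) (lam : ℝ≥0) : H →L[ℂ] H :=
  (A - (lam : ℂ) • ContinuousLinearMap.id ℂ H).ker.starProjection

/-- `tr (P Q) = tr (P Q P) ∈ [0, ∞]` for the projections `P` and `Q` onto the eigenspaces of `ρ`
for `lam` and of `σ` for `mu`. -/
def overlap (ρ σ : H →L[ℂ] H) (lam mu : ℝ≥0) : ℝ≥0∞ :=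
  trace (eigenProj ρ lam * eigenProj σ mu * eigenProj ρ lam)

/-- `lam (log lam - log mu) ∈ (-∞, ∞]`. It is `0` for `lam = 0` and `∞` for `lam > 0 = mu`. -/
def logTerm (lam mu : ℝ≥0) : EReal :=
  ((lam : ℝ≥0∞) : EReal) * (ENNReal.log (lam : ℝ≥0∞) - ENNReal.log (mu : ℝ≥0∞))

/-- `tr ρ (log ρ - log σ)` for non-negative operators `ρ` and `σ` of finite trace. Inserting the
spectral decompositions `ρ = ∑ lam P_lam` and `σ = ∑ mu Q_mu`, it is the double series of
`lam (log lam - log mu) tr (P_lam Q_mu)`, the sum of the positive terms minus the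
sum of the absolute values of the negative terms. The latter sum is at most `tr σ`, since
`lam (log mu - log lam) ≤ mu - lam`. The former is infinite if the kernel of `σ` is not
contained in the kernel of `ρ`. -/
def umegaki (ρ σ : H →L[ℂ] H) : EReal :=
  ((∑' lam : ℝ≥0, ∑' mu : ℝ≥0,
      (logTerm lam mu).toENNReal * overlap ρ σ lam mu : ℝ≥0∞) : EReal)
    - ((∑' lam : ℝ≥0, ∑' mu : ℝ≥0,
      (-logTerm lam mu).toENNReal * overlap ρ σ lam mu : ℝ≥0∞) : EReal)

/-- `tr (σ^((1-α)/(2α)) ρ σ^((1-α)/(2α)))^α ∈ [0, ∞]` for `0 < α < 1`. -/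
def sandwichedTrace (α : ℝ) (ρ σ : H →L[ℂ] H) : ℝ≥0∞ :=
  trace ((σ ^ ((1 - α) / (2 * α)) * ρ * σ ^ ((1 - α) / (2 * α))) ^ α)

/-- The quantum (sandwiched) Rényi divergence `D_α(ρ‖σ)` for `0 < α ≤ 1`, with extended real
values; here `ENNReal.log` is the logarithm on `[0, ∞]` with `log 0 = -∞` and `log ∞ = ∞`. -/
def divergence (α : ℝ) (ρ σ : H →L[ℂ] H) : EReal :=
  if α = 1 then (((trace ρ)⁻¹ : ℝ≥0∞) : EReal) * umegaki ρ σ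
  else (((α - 1)⁻¹ : ℝ) : EReal) * ENNReal.log ((trace ρ)⁻¹ * sandwichedTrace α ρ σ)

end RenyiDivergence

end

/-!
For `α < 1` the factor `(α - 1)⁻¹` is negative and `log` is concave and increasing, so it suffices
that `Q (ρ, σ) = tr (σ ^ s ρ σ ^ s) ^ α`, with `s = (1 - α) / (2 α)`, is jointly concave
(`sandwichedTrace_concave`). For `α = 1` the divergence is a limit of difference quotients at `p = 0`
of the concave functions `tr (σ ^ p ρ ^ (1 - p))` (`spectralSum_relTerm_convex`).

Both parts rest on **Lieb's concavity theorem** (`liebTrace_concave`). It is proved as follows. The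
trace of the parallel sum of left multiplication by `A` and right multiplication by `t Z` is an
infimum of functions that are affine in `(A, Z)`, hence jointly concave (`parallelTrace_concave`),
and `m ^ (1 - p) A ^ p` is an integral over `t` of such parallel sums with a positive measure.

To see that `Q` is concave, let `A` and `R` be the convex combinations of the `σᵢ` and the `ρᵢ`, let
`p = 2 s` and `T = A ^ s R A ^ s`. The singular value decomposition of `σᵢ ^ s ρᵢ ^ (1 / 2)` writes
`Q (ρᵢ, σᵢ)` as a sum of numbers `|⟨hₖ, σᵢ ^ s ρᵢ ^ (1 / 2) eₖ⟩| ^ (2 α)`. Formally, insert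
`1 = N K` with `N = A ^ (-s) T ^ ((1 - α) / 2)` and `K = T ^ (-(1 - α) / 2) A ^ s` between the two
factors. Hölder's inequality (`sum_norm_inner_rpow_le`) and the weighted arithmetic-geometric mean
inequality bound the sum by
`α tr (K ρᵢ K*) + (1 - α) tr (N* σᵢ ^ p N) ^ (1 / p)`.
In the convex combination, the first term becomes `α tr (K R K*) = α tr T ^ α`. The second term is
concave in `σᵢ` by Epstein's inequality (`trace_add_le_of_rpow_le`), a consequence of Lieb's theorem,
so it becomes at most `(1 - α) tr (N* A ^ p N) ^ (1 / p) = (1 - α) tr T ^ α`. Altogether this is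
`tr T ^ α`, the value of `Q` at `(R, A)`. As `A` and `T` need not be invertible, and `tr T ^ α` and
`tr σᵢ` may be infinite, the inverse powers are regularized, the sums are cut off to finitely many
terms, and Epstein's inequality is stated as a comparison of operators without the power `1 / p`.
-/

universe u

namespace RenyiDivergence

/-! ### Quadratic forms and traces -/

section

variable {H : Type*} [NormedAddCommGroup H] [InnerProductSpace ℂ H]

/-- The quadratic form `x ↦ Re ⟨x, A x⟩` of a bounded operator `A`. -/
noncomputable def quad (A : H →L[ℂ] H) (x : H) : ℝ := (inner ℂ x (A x)).re

theorem quad_add (A B : H →L[ℂ] H) (x : H) : quad (A + B) x = quad A x + quad B x := by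
  simp [quad]

theorem quad_smul (a : ℝ) (A : H →L[ℂ] H) (x : H) : quad (a • A) x = a * quad A x := by
  have : (a • A) x = (a : ℂ) • A x := by simp
  rw [quad, this, inner_smul_right, Complex.re_ofReal_mul, quad]

theorem quad_nonneg {A : H →L[ℂ] H} (hA : 0 ≤ A) (x : H) : 0 ≤ quad A x :=
  ((ContinuousLinearMap.nonneg_iff_isPositive A).1 hA).re_inner_nonneg_right x

variable [CompleteSpace H]

theorem quad_mono {A B : H →L[ℂ] H} (h : A ≤ B) (x : H) : quad A x ≤ quad B x := by
  have h1 := quad_nonneg (sub_nonneg.2 h) x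
  have h2 := quad_add A (B - A) x
  rw [add_sub_cancel] at h2
  linarith

theorem trace_eq_tsum_quad {ι : Type*} (b : HilbertBasis ι ℂ H) {A : H →L[ℂ] H} (hA : 0 ≤ A) :
    trace A = ∑' i, ENNReal.ofReal (quad A (b i)) := trace_eq_tsum b hA

theorem inner_star_apply (B : H →L[ℂ] H) (x y : H) : inner ℂ (star B x) y = inner ℂ x (B y) :=
  ContinuousLinearMap.adjoint_inner_left B y x

theorem inner_apply_comm {A : H →L[ℂ] H} (hA : IsSelfAdjoint A) (x y : H) :
    inner ℂ (A x) y = inner ℂ x (A y) := by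
  conv_lhs => rw [← hA.star_eq]
  exact inner_star_apply A x y

theorem quad_conj (A B : H →L[ℂ] H) (x : H) : quad (star B * A * B) x = quad A (B x) := by
  have : (star B * A * B) x = star B (A (B x)) := rfl
  rw [quad, this, ← inner_conj_symm, inner_star_apply, inner_conj_symm, quad]

theorem quad_star_mul_self (B : H →L[ℂ] H) (x : H) : quad (star B * B) x = ‖B x‖ ^ 2 := by
  have := quad_conj 1 B x
  rw [mul_one] at this
  rw [this, quad]
  exact inner_self_eq_norm_sq (𝕜 := ℂ) (B x)

theorem nonneg_linear {A B : H →L[ℂ] H} (hA : 0 ≤ A) (hB : 0 ≤ B) {a b : ℝ} (ha : 0 ≤ a)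
    (hb : 0 ≤ b) : 0 ≤ a • A + b • B :=
  add_nonneg (smul_nonneg ha hA) (smul_nonneg hb hB)

theorem trace_linear {A B : H →L[ℂ] H} (hA : 0 ≤ A) (hB : 0 ≤ B) {a b : ℝ} (ha : 0 ≤ a)
    (hb : 0 ≤ b) :
    trace (a • A + b • B) = ENNReal.ofReal a * trace A + ENNReal.ofReal b * trace B := by
  rw [trace, trace, trace, ← ENNReal.tsum_mul_left, ← ENNReal.tsum_mul_left, ← ENNReal.tsum_add]
  refine tsum_congr fun i => ?_
  have h := quad_add (a • A) (b • B) (basis H i)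
  rw [quad_smul, quad_smul] at h
  change ENNReal.ofReal (quad _ _) = _ * ENNReal.ofReal (quad _ _) + _ * ENNReal.ofReal (quad _ _)
  rw [h, ENNReal.ofReal_add (mul_nonneg ha (quad_nonneg hA _)) (mul_nonneg hb (quad_nonneg hB _)),
    ENNReal.ofReal_mul ha, ENNReal.ofReal_mul hb]

theorem trace_mono {A B : H →L[ℂ] H} (h : A ≤ B) : trace A ≤ trace B :=
  ENNReal.tsum_le_tsum fun _ => ENNReal.ofReal_le_ofReal (quad_mono h _)

theorem trace_star_mul_self {ι : Type*} (b : HilbertBasis ι ℂ H) (B : H →L[ℂ] H) :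
    trace (star B * B) = ∑' i, ENNReal.ofReal (‖B (b i)‖ ^ 2) := by
  rw [trace_eq_tsum_quad b (star_mul_self_nonneg B)]
  simp only [quad_star_mul_self]

/-- The Hilbert–Schmidt norms of `B` and of its adjoint agree. -/
theorem trace_star_mul_self_comm (B : H →L[ℂ] H) : trace (star B * B) = trace (B * star B) := by
  have h := trace_star_mul_self (basis H) (star B)
  rw [star_star] at h
  rw [h, trace_star_mul_self (basis H)]
  calc ∑' i, ENNReal.ofReal (‖B (basis H i)‖ ^ 2)
      = ∑' i, ∑' j, ENNReal.ofReal (‖inner ℂ (basis H j) (B (basis H i))‖ ^ 2) := by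
        simp only [tsum_ofReal_norm_sq]
    _ = ∑' j, ∑' i, ENNReal.ofReal (‖inner ℂ (basis H j) (B (basis H i))‖ ^ 2) :=
        ENNReal.tsum_comm
    _ = ∑' j, ∑' i, ENNReal.ofReal (‖inner ℂ (basis H i) (star B (basis H j))‖ ^ 2) := by
        refine tsum_congr fun j => tsum_congr fun i => ?_
        rw [← inner_star_apply, norm_inner_symm]
    _ = ∑' j, ENNReal.ofReal (‖star B (basis H j)‖ ^ 2) := by simp only [tsum_ofReal_norm_sq]

/-- Bessel's inequality for the Hilbert–Schmidt norm. -/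
theorem sum_norm_sq_le_trace {κ : Type*} {e : κ → H} (he : Orthonormal ℂ e) (s : Finset κ)
    (Y : H →L[ℂ] H) :
    ∑ k ∈ s, ENNReal.ofReal (‖Y (e k)‖ ^ 2) ≤ trace (star Y * Y) := by
  have h := trace_star_mul_self (basis H) (star Y)
  rw [star_star] at h
  rw [trace_star_mul_self_comm, h]
  calc ∑ k ∈ s, ENNReal.ofReal (‖Y (e k)‖ ^ 2)
      = ∑ k ∈ s, ∑' j, ENNReal.ofReal (‖inner ℂ (basis H j) (Y (e k))‖ ^ 2) := by
        simp only [tsum_ofReal_norm_sq]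
    _ = ∑' j, ∑ k ∈ s, ENNReal.ofReal (‖inner ℂ (basis H j) (Y (e k))‖ ^ 2) :=
        (Summable.tsum_finsetSum fun _ _ => ENNReal.summable).symm
    _ ≤ ∑' j, ENNReal.ofReal (‖star Y (basis H j)‖ ^ 2) := by
        refine ENNReal.tsum_le_tsum fun j => ?_
        rw [← ENNReal.ofReal_sum_of_nonneg fun _ _ => by positivity]
        refine ENNReal.ofReal_le_ofReal ?_
        refine le_trans (le_of_eq ?_) (he.sum_inner_products_le (star Y (basis H j)) (s := s))
        refine Finset.sum_congr rfl fun k _ => ?_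
        rw [← inner_star_apply, norm_inner_symm]

end

/-! ### Diagonalization of operators of finite trace -/

section

variable {H : Type u} [NormedAddCommGroup H] [InnerProductSpace ℂ H]

theorem quad_eigenvector {A : H →L[ℂ] H} {x : H} {l : ℝ} (h : A x = (l : ℂ) • x) :
    quad A x = l * ‖x‖ ^ 2 := by
  rw [quad, h, inner_smul_right, Complex.re_ofReal_mul]
  congr 1
  exact inner_self_eq_norm_sq (𝕜 := ℂ) x

theorem mem_spectrum_of_eigenvector {A : H →L[ℂ] H} {x : H} (hx : x ≠ 0) {l : ℝ}
    (h : A x = (l : ℂ) • x) : l ∈ spectrum ℝ A := by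
  rw [spectrum.mem_iff]
  rintro ⟨u, hu⟩
  have h1 : (u : H →L[ℂ] H) x = 0 := by
    rw [hu, sub_apply, h, Algebra.algebraMap_eq_smul_one]
    simp
  have h2 : ((↑u⁻¹ * ↑u : H →L[ℂ] H)) x = 0 := by
    rw [mul_apply_eq_comp, h1, map_zero]
  rw [Units.inv_mul] at h2
  exact hx h2

variable [CompleteSpace H]

/-- A Hilbert–Schmidt operator `S` is compact: it is the norm limit of the finite-rank operators
`P S`, where `P` is the projection onto the span of finitely many basis vectors. -/
theorem isCompactOperator_of_hilbertSchmidt {S : H →L[ℂ] H} (hS : trace (star S * S) ≠ ⊤) :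
    IsCompactOperator S := by
  classical
  set b := basis H
  let G : Finset (basisIndex H) → H →L[ℂ] H := fun F =>
    ∑ i ∈ F, (InnerProductSpace.rankOne ℂ (b i) (b i)).comp S
  have hG : ∀ F x, G F x = ∑ i ∈ F, inner ℂ (b i) (S x) • b i := by
    intro F x
    simp [G]
  rw [trace_star_mul_self_comm, ← star_star S, star_star (star S),
    trace_star_mul_self b (star S)] at hS
  have hbound : ∀ F x, ENNReal.ofReal (‖(G F - S) x‖ ^ 2) ≤
      (∑' i : {i // i ∉ F}, ENNReal.ofReal (‖star S (b i)‖ ^ 2)) * ENNReal.ofReal (‖x‖ ^ 2) := by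
    intro F x
    have hc : ∀ i, inner ℂ (b i) ((G F - S) x) = if i ∈ F then 0 else -inner ℂ (b i) (S x) := by
      intro i
      rw [sub_apply, hG, inner_sub_right, inner_sum]
      simp only [inner_smul_right, orthonormal_iff_ite.1 b.orthonormal, mul_ite, mul_one, mul_zero,
        Finset.sum_ite_eq]
      split_ifs <;> simp
    rw [← tsum_ofReal_norm_sq b, ← tsum_subtype_eq_of_support_subset (s := {i | i ∉ F}),
      ← ENNReal.tsum_mul_right]
    · refine ENNReal.tsum_le_tsum fun i => ?_
      rw [hc, if_neg i.2, norm_neg, ← ENNReal.ofReal_mul (by positivity), ← mul_pow]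
      refine ENNReal.ofReal_le_ofReal (pow_le_pow_left₀ (norm_nonneg _) ?_ 2)
      rw [← inner_star_apply]
      exact norm_inner_le_norm _ _
    · intro i hi
      by_contra hiF
      simp only [Set.mem_ofPred_eq, not_not] at hiF
      rw [Function.mem_support, hc, if_pos hiF] at hi
      simp at hi
  have hlim : Filter.Tendsto G Filter.atTop (nhds S) := by
    rw [Metric.tendsto_nhds]
    intro ε hε
    have h0 := ENNReal.tendsto_tsum_compl_atTop_zero hS
    have h1 : (0 : ℝ≥0∞) < ENNReal.ofReal ((ε / 2) ^ 2) := ENNReal.ofReal_pos.2 (by positivity)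
    filter_upwards [h0.eventually (gt_mem_nhds h1)] with F hF
    rw [dist_eq_norm]
    refine lt_of_le_of_lt (ContinuousLinearMap.opNorm_le_bound _ (by positivity : 0 ≤ ε / 2) ?_)
      (by linarith)
    intro x
    have h2 : ENNReal.ofReal (‖(G F - S) x‖ ^ 2) ≤
        ENNReal.ofReal ((ε / 2) ^ 2) * ENNReal.ofReal (‖x‖ ^ 2) :=
      (hbound F x).trans (mul_le_mul hF.le le_rfl zero_le zero_le)
    rw [← ENNReal.ofReal_mul (by positivity), ENNReal.ofReal_le_ofReal_iff (by positivity),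
      ← mul_pow] at h2
    exact (pow_le_pow_iff_left₀ (norm_nonneg _) (by positivity) two_ne_zero).1 h2
  refine isCompactOperator_of_tendsto hlim (Filter.Eventually.of_forall fun F => ?_)
  change G F ∈ compactOperator (RingHom.id ℂ) H H
  refine Submodule.sum_mem _ fun i _ => ?_
  change IsCompactOperator _
  have : (InnerProductSpace.rankOne ℂ (b i) (b i)).comp S =
      (ContinuousLinearMap.toSpanSingleton ℂ (b i)).comp ((innerSL ℂ (b i)).comp S) := by
    ext x
    simp
  rw [this]
  exact (isCompactOperator_of_locallyCompactSpace_rng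
    (ContinuousLinearMap.toSpanSingleton ℂ (b i))).comp_clm ((innerSL ℂ (b i)).comp S)

theorem isCompactOperator_of_trace_ne_top {Z : H →L[ℂ] H} (hZ : 0 ≤ Z) (hfin : trace Z ≠ ⊤) :
    IsCompactOperator Z := by
  have hS : star (CFC.sqrt Z) * CFC.sqrt Z = Z := by
    rw [(IsSelfAdjoint.of_nonneg (CFC.sqrt_nonneg Z)).star_eq, CFC.sqrt_mul_sqrt_self Z hZ]
  have h := isCompactOperator_of_hilbertSchmidt (S := CFC.sqrt Z) (by rwa [hS])
  rw [← hS]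
  exact h.clm_comp (star (CFC.sqrt Z))

/-- A non-negative operator of finite trace has a Hilbert basis of eigenvectors. -/
theorem exists_eigenbasis {Z : H →L[ℂ] H} (hZ : 0 ≤ Z) (hfin : trace Z ≠ ⊤) :
    ∃ (ι : Type u) (b : HilbertBasis ι ℂ H) (z : ι → ℝ≥0), ∀ j, Z (b j) = ((z j : ℝ) : ℂ) • b j := by
  have hsym : (Z : H →ₗ[ℂ] H).IsSymmetric :=
    ((ContinuousLinearMap.nonneg_iff_isPositive Z).1 hZ).isSymmetric
  have hbot := ContinuousLinearMap.orthogonalComplement_iSup_eigenspaces_eq_bot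
    (isCompactOperator_of_trace_ne_top hZ hfin) hsym
  let E : ℂ → Submodule ℂ H := fun l => Module.End.eigenspace (Z : Module.End ℂ H) l
  have hclosed : ∀ l, IsClosed (E l : Set H) := by
    intro l
    have : (E l : Set H) = {x | Z x = l • x} := by
      ext x
      simp [E]
    rw [this]
    exact isClosed_eq Z.continuous (continuous_const_smul l)
  have : ∀ l, CompleteSpace (E l) := fun l => (hclosed l).completeSpace_coe
  have hw := fun l => exists_hilbertBasis ℂ (E l)
  choose w c hc using hw
  have hon := hsym.orthogonalFamily_eigenspaces.orthonormal_sigma_orthonormal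
    (v_family := fun l => c l) (fun l => (c l).orthonormal)
  have hspan : (Submodule.span ℂ (Set.range fun a : (Σ l, w l) =>
      (E a.1).subtypeₗᵢ (c a.1 a.2)))ᗮ = ⊥ := by
    rw [eq_bot_iff, ← hbot]
    intro x hx
    rw [Submodule.mem_orthogonal] at hx ⊢
    intro y hy
    refine Submodule.iSup_induction E (motive := fun y => inner ℂ y x = 0) hy ?_ (by simp) ?_
    · intro l y hy
      have hz : ((E l).orthogonalProjectionOnto x : E l) = 0 := by
        refine ((c l).hasSum_repr ((E l).orthogonalProjectionOnto x)).unique ?_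
        convert hasSum_zero with i
        have h0 : inner ℂ ((c l i : E l) : H) x = 0 :=
          hx _ (Submodule.subset_span ⟨⟨l, i⟩, rfl⟩)
        rw [HilbertBasis.repr_apply_apply, Submodule.inner_orthogonalProjectionOnto_eq_of_mem_left,
          h0, zero_smul]
      have h1 := Submodule.inner_orthogonalProjectionOnto_eq_of_mem_left (⟨y, hy⟩ : E l) x
      rw [hz, inner_zero_right] at h1
      exact h1.symm
    · intro y1 y2 h1 h2
      rw [inner_add_left, h1, h2, add_zero]
  let b := HilbertBasis.mkOfOrthogonalEqBot hon hspan
  have hb : ∀ a, b a = (c a.1 a.2 : H) := by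
    intro a
    simp [b]
  have heig : ∀ a, Z (b a) = a.1 • b a := by
    intro a
    rw [hb]
    exact Module.End.mem_eigenspace_iff.1 (c a.1 a.2).2
  refine ⟨_, b, fun a => (quad Z (b a)).toNNReal, fun a => ?_⟩
  have hn : inner ℂ (b a) (b a) = 1 := by
    rw [inner_self_eq_norm_sq_to_K, b.orthonormal.1]; simp
  have h1 : inner ℂ (b a) (Z (b a)) = a.1 := by
    rw [heig, inner_smul_right, hn, mul_one]
  have h2 : ((quad Z (b a) : ℝ) : ℂ) = a.1 := by
    rw [← h1, quad]
    have h3 := inner_apply_comm (IsSelfAdjoint.of_nonneg hZ) (b a) (b a)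
    rw [← inner_conj_symm] at h3
    exact Complex.conj_eq_iff_re.1 h3
  rw [Real.coe_toNNReal _ (quad_nonneg hZ _), h2, heig]

/-- The continuous functional calculus acts on eigenvectors as expected. The reason is that, for
every `ε > 0`, `(f t - f l) ^ 2 ≤ ε + C (t - l) ^ 2` on the spectrum for some `C`. -/
theorem cfc_apply_eigenvector {A : H →L[ℂ] H} (hA : IsSelfAdjoint A) {f : ℝ → ℝ}
    (hf : ContinuousOn f (spectrum ℝ A)) {x : H} {l : ℝ} (h : A x = (l : ℂ) • x) :
    cfc f A x = (f l : ℂ) • x := by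
  rcases eq_or_ne x 0 with rfl | hx
  · simp
  have hl := mem_spectrum_of_eigenvector hx h
  set g : ℝ → ℝ := fun t => f t - f l with hg
  have hgc : ContinuousOn g (spectrum ℝ A) := hf.sub continuousOn_const
  have h0 : cfc g A = cfc f A - (f l) • (1 : H →L[ℂ] H) := by
    rw [hg, cfc_sub f (fun _ => f l) A hf continuousOn_const, cfc_const (f l) A hA,
      Algebra.algebraMap_eq_smul_one]
  have hlin : cfc (fun t => t - l) A x = 0 := by
    rw [cfc_sub (fun t => t) (fun _ => l) A, cfc_id' ℝ A hA, cfc_const l A hA,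
      Algebra.algebraMap_eq_smul_one, sub_apply, h]
    simp
  have hsq : ∀ k : ℝ → ℝ, ContinuousOn k (spectrum ℝ A) →
      quad (cfc (fun t => k t ^ 2) A) x = ‖cfc k A x‖ ^ 2 := by
    intro k hk
    rw [← quad_star_mul_self, (cfc_predicate k A).star_eq, ← cfc_mul k k A hk hk]
    simp only [sq]
  have key : ∀ ε > 0, ‖cfc g A x‖ ^ 2 ≤ ε * ‖x‖ ^ 2 := by
    intro ε hε
    obtain ⟨δ, hδ, hδ'⟩ : ∃ δ > 0, ∀ t ∈ spectrum ℝ A, |t - l| < δ → g t ^ 2 ≤ ε := by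
      have h1 : Filter.Tendsto (fun t => g t ^ 2) (nhdsWithin l (spectrum ℝ A))
          (nhds (g l ^ 2)) := (hgc.pow 2) l hl
      have h2 : g l ^ 2 < ε := by simpa [hg] using hε
      obtain ⟨δ, hδ, h3⟩ := Metric.mem_nhdsWithin_iff.1 (h1.eventually (gt_mem_nhds h2))
      refine ⟨δ, hδ, fun t ht htl => (h3 ⟨?_, ht⟩ : _ < _).le⟩
      rwa [Metric.mem_ball, Real.dist_eq]
    obtain ⟨C, hC⟩ := (spectrum.isCompact A (𝕜 := ℝ)).exists_bound_of_continuousOn (hgc.pow 2)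
    have hC0 : 0 ≤ C := (norm_nonneg _).trans (hC l hl)
    have hle : cfc (fun t => g t ^ 2) A ≤ cfc (fun t => ε + C / δ ^ 2 * (t - l) ^ 2) A := by
      refine cfc_mono (fun t ht => ?_) (hgc.pow 2) (by fun_prop)
      by_cases htl : |t - l| < δ
      · exact (hδ' t ht htl).trans (le_add_of_nonneg_right (by positivity))
      · have h1 : δ ^ 2 ≤ (t - l) ^ 2 := by
          rw [← sq_abs (t - l)]
          exact pow_le_pow_left₀ hδ.le (not_lt.1 htl) 2
        have h2 : C ≤ C / δ ^ 2 * (t - l) ^ 2 := by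
          rw [div_mul_eq_mul_div, le_div_iff₀ (by positivity)]
          exact mul_le_mul_of_nonneg_left h1 hC0
        have h3 : g t ^ 2 ≤ C := (le_abs_self _).trans (hC t ht)
        linarith
    have h2 := quad_mono hle x
    rw [hsq g hgc, cfc_add (a := A) (fun _ => ε) (fun t => C / δ ^ 2 * (t - l) ^ 2),
      cfc_const_mul (C / δ ^ 2) (fun t => (t - l) ^ 2) A, cfc_const ε A hA,
      Algebra.algebraMap_eq_smul_one, quad_add, quad_smul, quad_smul,
      hsq (fun t => t - l) (by fun_prop), hlin] at h2
    have h4 : quad (1 : H →L[ℂ] H) x = ‖x‖ ^ 2 := inner_self_eq_norm_sq (𝕜 := ℂ) x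
    simpa [h4] using h2
  have hz : cfc g A x = 0 := by
    have h5 : ‖cfc g A x‖ ^ 2 ≤ 0 := by
      refine le_of_forall_pos_le_add fun ε hε => ?_
      have h6 := key (ε / (‖x‖ ^ 2 + 1)) (by positivity)
      refine h6.trans ?_
      rw [zero_add, div_mul_eq_mul_div, div_le_iff₀ (by positivity)]
      nlinarith
    have h7 := pow_eq_zero_iff two_ne_zero |>.1 (le_antisymm h5 (by positivity))
    exact norm_eq_zero.1 h7
  rw [h0, sub_apply, sub_eq_zero] at hz
  rw [hz]
  simp

theorem rpow_apply_eigenvector {A : H →L[ℂ] H} (hA : 0 ≤ A) {p : ℝ} (hp : 0 ≤ p) {x : H} {l : ℝ}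
    (h : A x = (l : ℂ) • x) : (A ^ p) x = ((l ^ p : ℝ) : ℂ) • x := by
  rw [CFC.rpow_eq_cfc_real (a := A)]
  exact cfc_apply_eigenvector (IsSelfAdjoint.of_nonneg hA)
    (Real.continuous_rpow_const hp).continuousOn h

end

/-! ### Lieb's concavity theorem -/

section

variable {H : Type*} [NormedAddCommGroup H] [InnerProductSpace ℂ H]

/-- `b` is a Hilbert basis of eigenvectors of `Z`, with eigenvalues `z`. -/
def IsEigenbasis {ι : Type*} (Z : H →L[ℂ] H) (b : HilbertBasis ι ℂ H) (z : ι → ℝ≥0) : Prop :=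
  ∀ j, Z (b j) = ((z j : ℝ) : ℂ) • b j

variable [CompleteSpace H]

theorem IsEigenbasis.quad_rpow {ι : Type*} {Z : H →L[ℂ] H} {b : HilbertBasis ι ℂ H} {z : ι → ℝ≥0}
    (hb : IsEigenbasis Z b z) (hZ : 0 ≤ Z) {p : ℝ} (hp : 0 ≤ p) (j : ι) :
    quad (Z ^ p) (b j) = (z j : ℝ) ^ p := by
  rw [quad_eigenvector (rpow_apply_eigenvector hZ hp (hb j)), b.orthonormal.1, one_pow, mul_one]

theorem IsEigenbasis.trace_rpow {ι : Type*} {Z : H →L[ℂ] H} {b : HilbertBasis ι ℂ H}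
    {z : ι → ℝ≥0} (hb : IsEigenbasis Z b z) (hZ : 0 ≤ Z) {p : ℝ} (hp : 0 ≤ p) :
    trace (Z ^ p) = ∑' j, ENNReal.ofReal ((z j : ℝ) ^ p) := by
  rw [trace_eq_tsum_quad b CFC.rpow_nonneg]
  simp only [hb.quad_rpow hZ hp]

theorem IsEigenbasis.trace_eq {ι : Type*} {Z : H →L[ℂ] H} {b : HilbertBasis ι ℂ H}
    {z : ι → ℝ≥0} (hb : IsEigenbasis Z b z) (hZ : 0 ≤ Z) : trace Z = ∑' j, (z j : ℝ≥0∞) := by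
  have h := hb.trace_rpow hZ zero_le_one
  rw [CFC.rpow_one Z] at h
  rw [h]
  exact tsum_congr fun j => by rw [Real.rpow_one, ENNReal.ofReal_coe_nnreal]

theorem IsEigenbasis.trace_conj {ι : Type*} {Z : H →L[ℂ] H} {b : HilbertBasis ι ℂ H}
    {z : ι → ℝ≥0} (hb : IsEigenbasis Z b z) (hZ : 0 ≤ Z) (Y : H →L[ℂ] H) :
    trace (Y * Z * star Y) = ∑' j, ENNReal.ofReal (z j * ‖Y (b j)‖ ^ 2) := by
  have hs : IsSelfAdjoint (Z ^ (1 / 2 : ℝ)) := IsSelfAdjoint.of_nonneg CFC.rpow_nonneg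
  have h1 : Y * Z * star Y = (Y * Z ^ (1 / 2 : ℝ)) * star (Y * Z ^ (1 / 2 : ℝ)) := by
    rw [star_mul, hs.star_eq, ← mul_assoc, mul_assoc Y (Z ^ (1 / 2 : ℝ)), ← CFC.sqrt_eq_rpow,
      CFC.sqrt_mul_sqrt_self Z]
  rw [h1, ← trace_star_mul_self_comm, trace_star_mul_self b]
  refine tsum_congr fun j => ?_
  rw [mul_apply_eq_comp, rpow_apply_eigenvector hZ (by norm_num) (hb j), map_smul, norm_smul,
    mul_pow, Complex.norm_real, Real.norm_eq_abs, sq_abs, ← Real.sqrt_eq_rpow,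
    Real.sq_sqrt (NNReal.coe_nonneg _)]

/-- The parallel sum `A m / (A + t m)` of `A / t` and of the scalar `m`. -/
noncomputable def parallelSum (t m : ℝ) (A : H →L[ℂ] H) : H →L[ℂ] H :=
  cfc (fun x : ℝ => x * m / (x + t * m)) A

theorem continuousOn_div_add {A : H →L[ℂ] H} (hA : 0 ≤ A) {c : ℝ} (hc : 0 < c) {f : ℝ → ℝ}
    (hf : Continuous f) : ContinuousOn (fun x => f x / (x + c)) (spectrum ℝ A) := by
  refine hf.continuousOn.div (by fun_prop) fun x hx => ?_
  have := spectrum_nonneg_of_nonneg hA hx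
  positivity

theorem parallelSum_nonneg {A : H →L[ℂ] H} (hA : 0 ≤ A) {t m : ℝ} (ht : 0 < t) (hm : 0 ≤ m) :
    0 ≤ parallelSum t m A := by
  refine cfc_nonneg fun x hx => ?_
  have := spectrum_nonneg_of_nonneg hA hx
  positivity

/-- Completing the square: the minimum of `x ↦ ⟨x, A x⟩ / t + m ‖v - x‖ ^ 2` is the quadratic form
of the parallel sum at `v`. -/
theorem exists_quad_parallelSum {A : H →L[ℂ] H} (hA : 0 ≤ A) {t m : ℝ} (ht : 0 < t) (hm : 0 ≤ m)
    (v : H) :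
    ∃ C : H →L[ℂ] H, 0 ≤ C ∧ ∃ x₀ : H, ∀ x,
      t⁻¹ * quad A x + m * ‖v - x‖ ^ 2 = quad C (x - x₀) + quad (parallelSum t m A) v := by
  have hsa : IsSelfAdjoint A := IsSelfAdjoint.of_nonneg hA
  rcases hm.eq_or_lt with rfl | hm
  · refine ⟨t⁻¹ • A, smul_nonneg (by positivity) hA, 0, fun x => ?_⟩
    simp [parallelSum, quad]
  have hc : 0 < t * m := by positivity
  set g : H →L[ℂ] H := cfc (fun x : ℝ => t * m / (x + t * m)) A with hg
  set C : H →L[ℂ] H := t⁻¹ • A + m • 1 with hC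
  have hC0 : 0 ≤ C := add_nonneg (smul_nonneg (by positivity) hA) (smul_nonneg hm.le zero_le_one)
  have hCsa : IsSelfAdjoint C := IsSelfAdjoint.of_nonneg hC0
  have hgc := continuousOn_div_add hA hc (f := fun _ => t * m) continuous_const
  have hCcfc : C = cfc (fun x : ℝ => t⁻¹ * x + m) A := by
    rw [cfc_add (a := A) (fun x : ℝ => t⁻¹ * x) (fun _ => m), cfc_const_mul_id t⁻¹ A,
      cfc_const m A, Algebra.algebraMap_eq_smul_one]
  have hCg : C * g = m • 1 := by
    rw [hCcfc, hg, ← cfc_mul _ _ A (by fun_prop) hgc, ← Algebra.algebraMap_eq_smul_one,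
      ← cfc_const m A]
    refine cfc_congr fun x hx => ?_
    have := spectrum_nonneg_of_nonneg hA hx
    have h2 : x + t * m ≠ 0 := by positivity
    field_simp
  have hpar : parallelSum t m A = m • 1 - m • g := by
    rw [parallelSum, hg, ← cfc_smul m _ A hgc, ← Algebra.algebraMap_eq_smul_one,
      ← cfc_const m A, ← cfc_sub (fun _ : ℝ => m) (fun x : ℝ => m • (t * m / (x + t * m))) A
        continuousOn_const (hgc.const_smul m)]
    refine cfc_congr fun x hx => ?_
    have := spectrum_nonneg_of_nonneg hA hx
    have h2 : x + t * m ≠ 0 := by positivity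
    simp only [smul_eq_mul]
    field_simp
    ring
  have hgsa : IsSelfAdjoint g := cfc_predicate _ A
  refine ⟨C, hC0, g v, fun x => ?_⟩
  have h1 : quad C x = t⁻¹ * quad A x + m * ‖x‖ ^ 2 := by
    have : quad (1 : H →L[ℂ] H) x = ‖x‖ ^ 2 := inner_self_eq_norm_sq (𝕜 := ℂ) x
    rw [hC, quad_add, quad_smul, quad_smul, this]
  have h2 : C (g v) = (m : ℂ) • v := by
    rw [← mul_apply_eq_comp, hCg]
    simp
  have h3 : quad C (x - g v) = quad C x - 2 * m * (inner ℂ x v).re + m * (inner ℂ (g v) v).re := by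
    have e1 : inner ℂ (g v) (C x) = (m : ℂ) * inner ℂ v x := by
      rw [← inner_apply_comm hCsa, h2, inner_smul_left, Complex.conj_ofReal]
    have e2 : (inner ℂ v x).re = (inner ℂ x v).re := inner_re_symm (𝕜 := ℂ) v x
    rw [quad, map_sub, h2, inner_sub_left, inner_sub_right, inner_sub_right, e1, inner_smul_right,
      inner_smul_right]
    simp only [Complex.sub_re, Complex.re_ofReal_mul, e2, quad]
    ring
  have h4 : quad (parallelSum t m A) v = m * ‖v‖ ^ 2 - m * (inner ℂ (g v) v).re := by
    have e0 : (m • 1 - m • g : H →L[ℂ] H) v = (m : ℂ) • v - (m : ℂ) • g v := by simp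
    rw [hpar, quad, e0, inner_sub_right, inner_smul_right, inner_smul_right,
      ← inner_apply_comm hgsa]
    simp only [Complex.sub_re, Complex.re_ofReal_mul]
    congr 2
    exact inner_self_eq_norm_sq (𝕜 := ℂ) v
  have h5 : ‖v - x‖ ^ 2 = ‖v‖ ^ 2 - 2 * (inner ℂ x v).re + ‖x‖ ^ 2 := by
    have := norm_sub_sq (𝕜 := ℂ) v x
    rw [this, inner_re_symm (𝕜 := ℂ) v x]
    rfl
  rw [h3, h1, h4, h5]
  ring

end

section

variable {H : Type*} [NormedAddCommGroup H] [InnerProductSpace ℂ H] [CompleteSpace H]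

/-- The trace `tr (K* A (A + t Z)⁻¹ Z K)`, where `A` acts from the left and `Z` from the right. The
operator `Z` is given by a Hilbert basis `b` of eigenvectors and the eigenvalues `z`. -/
noncomputable def parallelTrace {ι : Type*} (t : ℝ) (K A : H →L[ℂ] H) (b : HilbertBasis ι ℂ H)
    (z : ι → ℝ≥0) : ℝ≥0∞ :=
  ∑' j, ENNReal.ofReal (quad (parallelSum t (z j) A) (K (b j)))

theorem trace_conj_eq_tsum {ι : Type*} (b : HilbertBasis ι ℂ H) {A : H →L[ℂ] H} (hA : 0 ≤ A)
    (X : H →L[ℂ] H) : trace (star X * A * X) = ∑' j, ENNReal.ofReal (quad A (X (b j))) := by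
  rw [trace_eq_tsum_quad b (star_left_conjugate_nonneg hA X)]
  simp only [quad_conj]

theorem affine_eq_tsum {ι : Type*} {A Z : H →L[ℂ] H} (hA : 0 ≤ A) (hZ : 0 ≤ Z)
    {b : HilbertBasis ι ℂ H} {z : ι → ℝ≥0} (hb : IsEigenbasis Z b z) {t : ℝ} (ht : 0 < t)
    (K X : H →L[ℂ] H) :
    ENNReal.ofReal t⁻¹ * trace (star X * A * X) + trace ((K - X) * Z * star (K - X)) =
      ∑' j, ENNReal.ofReal (t⁻¹ * quad A (X (b j)) + z j * ‖K (b j) - X (b j)‖ ^ 2) := by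
  rw [trace_conj_eq_tsum b hA, hb.trace_conj hZ, ← ENNReal.tsum_mul_left, ← ENNReal.tsum_add]
  refine tsum_congr fun j => ?_
  have := quad_nonneg hA (X (b j))
  rw [← ENNReal.ofReal_mul (by positivity), ← ENNReal.ofReal_add (by positivity) (by positivity),
    sub_apply]

theorem parallelTrace_le {ι : Type*} {A Z : H →L[ℂ] H} (hA : 0 ≤ A) (hZ : 0 ≤ Z)
    {b : HilbertBasis ι ℂ H} {z : ι → ℝ≥0} (hb : IsEigenbasis Z b z) {t : ℝ} (ht : 0 < t)
    (K X : H →L[ℂ] H) :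
    parallelTrace t K A b z ≤
      ENNReal.ofReal t⁻¹ * trace (star X * A * X) + trace ((K - X) * Z * star (K - X)) := by
  rw [affine_eq_tsum hA hZ hb ht]
  refine ENNReal.tsum_le_tsum fun j => ENNReal.ofReal_le_ofReal ?_
  obtain ⟨C, hC, x₀, h⟩ := exists_quad_parallelSum hA ht (NNReal.coe_nonneg (z j)) (K (b j))
  rw [h]
  exact le_add_of_nonneg_left (quad_nonneg hC _)

/-- The bound of `parallelTrace_le` is attained up to `ε`, by an operator `X` of finite rank: it maps
finitely many basis vectors to the minimizers and the others to zero. -/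
theorem exists_le_parallelTrace_add {ι : Type*} {A Z : H →L[ℂ] H} (hA : 0 ≤ A) (hZ : 0 ≤ Z)
    (hfin : trace Z ≠ ⊤) {b : HilbertBasis ι ℂ H} {z : ι → ℝ≥0} (hb : IsEigenbasis Z b z) {t : ℝ}
    (ht : 0 < t) (K : H →L[ℂ] H) {ε : ℝ≥0∞} (hε : 0 < ε) :
    ∃ X : H →L[ℂ] H,
      ENNReal.ofReal t⁻¹ * trace (star X * A * X) + trace ((K - X) * Z * star (K - X)) ≤
        parallelTrace t K A b z + ε := by
  classical
  have hx : ∀ j, ∃ x, t⁻¹ * quad A x + z j * ‖K (b j) - x‖ ^ 2 =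
      quad (parallelSum t (z j) A) (K (b j)) := by
    intro j
    obtain ⟨C, -, x₀, h⟩ := exists_quad_parallelSum hA ht (NNReal.coe_nonneg (z j)) (K (b j))
    exact ⟨x₀, by rw [h]; simp [quad]⟩
  choose x hx using hx
  have hsum : ∑' j, ENNReal.ofReal (z j * ‖K (b j)‖ ^ 2) ≠ ⊤ := by
    refine ne_top_of_le_ne_top (b := ENNReal.ofReal (‖K‖ ^ 2) * trace Z)
      (ENNReal.mul_ne_top ENNReal.ofReal_ne_top hfin) ?_
    rw [hb.trace_eq hZ, ← ENNReal.tsum_mul_left]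
    refine ENNReal.tsum_le_tsum fun j => ?_
    rw [← ENNReal.ofReal_coe_nnreal, ← ENNReal.ofReal_mul (by positivity), mul_comm]
    refine ENNReal.ofReal_le_ofReal (mul_le_mul_of_nonneg_right ?_ (NNReal.coe_nonneg _))
    refine pow_le_pow_left₀ (norm_nonneg _) ((K.le_opNorm _).trans ?_) 2
    rw [b.orthonormal.1, mul_one]
  obtain ⟨F, hF⟩ : ∃ F : Finset ι,
      ∑' j : {j // j ∉ F}, ENNReal.ofReal (z j * ‖K (b j)‖ ^ 2) < ε :=
    ((ENNReal.tendsto_tsum_compl_atTop_zero hsum).eventually (gt_mem_nhds hε)).exists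
  let X : H →L[ℂ] H := ∑ j ∈ F, InnerProductSpace.rankOne ℂ (x j) (b j)
  have hX : ∀ j, X (b j) = if j ∈ F then x j else 0 := by
    intro j
    simp [X, orthonormal_iff_ite.1 b.orthonormal]
  refine ⟨X, ?_⟩
  rw [affine_eq_tsum hA hZ hb ht, parallelTrace]
  calc ∑' j, ENNReal.ofReal (t⁻¹ * quad A (X (b j)) + z j * ‖K (b j) - X (b j)‖ ^ 2)
      ≤ ∑' j, (ENNReal.ofReal (quad (parallelSum t (z j) A) (K (b j))) +
          Set.indicator {j | j ∉ F} (fun j => ENNReal.ofReal (z j * ‖K (b j)‖ ^ 2)) j) := by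
        refine ENNReal.tsum_le_tsum fun j => ?_
        rw [hX]
        by_cases hj : j ∈ F
        · rw [if_pos hj, hx]
          exact le_self_add
        · rw [if_neg hj, Set.indicator_of_mem (show j ∈ {j | j ∉ F} from hj)]
          have : quad A (0 : H) = 0 := by simp [quad]
          rw [this, mul_zero, zero_add, sub_zero]
          exact le_add_self
    _ = ∑' j, ENNReal.ofReal (quad (parallelSum t (z j) A) (K (b j))) +
          ∑' j : {j // j ∉ F}, ENNReal.ofReal (z j * ‖K (b j)‖ ^ 2) := by
        rw [ENNReal.tsum_add]
        congr 1
        exact (tsum_subtype {j | j ∉ F} fun j => ENNReal.ofReal (z j * ‖K (b j)‖ ^ 2)).symm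
    _ ≤ _ := by gcongr

/-- `parallelTrace` is jointly concave in the operators `A` and `Z`, being an infimum of affine
functions. -/
theorem parallelTrace_concave {ι ι₁ ι₂ : Type*} {A₁ A₂ Z₁ Z₂ : H →L[ℂ] H} (hA₁ : 0 ≤ A₁)
    (hA₂ : 0 ≤ A₂) (hZ₁ : 0 ≤ Z₁) (hZ₂ : 0 ≤ Z₂) {a c : ℝ} (ha : 0 ≤ a) (hc : 0 ≤ c)
    (hfin : trace (a • Z₁ + c • Z₂) ≠ ⊤)
    {b₁ : HilbertBasis ι₁ ℂ H} {z₁ : ι₁ → ℝ≥0} (hb₁ : IsEigenbasis Z₁ b₁ z₁)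
    {b₂ : HilbertBasis ι₂ ℂ H} {z₂ : ι₂ → ℝ≥0} (hb₂ : IsEigenbasis Z₂ b₂ z₂)
    {b : HilbertBasis ι ℂ H} {z : ι → ℝ≥0} (hb : IsEigenbasis (a • Z₁ + c • Z₂) b z)
    {t : ℝ} (ht : 0 < t) (K : H →L[ℂ] H) :
    ENNReal.ofReal a * parallelTrace t K A₁ b₁ z₁ + ENNReal.ofReal c * parallelTrace t K A₂ b₂ z₂ ≤
      parallelTrace t K (a • A₁ + c • A₂) b z := by
  have hA := nonneg_linear hA₁ hA₂ ha hc
  have hZ := nonneg_linear hZ₁ hZ₂ ha hc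
  refine ENNReal.le_of_forall_pos_le_add fun ε hε _ => ?_
  obtain ⟨X, hX⟩ := exists_le_parallelTrace_add hA hZ hfin hb ht K (ε := ε) (by exact_mod_cast hε)
  refine le_trans ?_ hX
  have e1 : star X * (a • A₁ + c • A₂) * X = a • (star X * A₁ * X) + c • (star X * A₂ * X) := by
    simp only [mul_add, add_mul, mul_smul_comm, smul_mul_assoc]
  have e2 : (K - X) * (a • Z₁ + c • Z₂) * star (K - X) =
      a • ((K - X) * Z₁ * star (K - X)) + c • ((K - X) * Z₂ * star (K - X)) := by
    simp only [mul_add, add_mul, mul_smul_comm, smul_mul_assoc]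
  rw [e1, e2, trace_linear (star_left_conjugate_nonneg hA₁ X) (star_left_conjugate_nonneg hA₂ X)
    ha hc, trace_linear (star_right_conjugate_nonneg hZ₁ _) (star_right_conjugate_nonneg hZ₂ _)
    ha hc]
  refine (add_le_add (mul_le_mul_right (parallelTrace_le hA₁ hZ₁ hb₁ ht K X) _)
    (mul_le_mul_right (parallelTrace_le hA₂ hZ₂ hb₂ ht K X) _)).trans (le_of_eq ?_)
  ring

/-- Lieb's function `tr (K* A ^ p K Z ^ (1 - p))`. The operator `Z` is given by a Hilbert basis `b`
of eigenvectors and the eigenvalues `z`. -/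
noncomputable def liebTrace {ι : Type*} (p : ℝ) (K A : H →L[ℂ] H) (b : HilbertBasis ι ℂ H)
    (z : ι → ℝ≥0) : ℝ≥0∞ :=
  ∑' j, ENNReal.ofReal ((z j : ℝ) ^ (1 - p) * quad (A ^ p) (K (b j)))

open MeasureTheory Set in
/-- Powers are superpositions of parallel sums. -/
theorem exists_measure_quad_rpow {p : ℝ} (hp : p ∈ Ioo (0 : ℝ) 1) :
    ∃ ν : Measure ℝ, ∀ (A : H →L[ℂ] H), 0 ≤ A → ∀ m : ℝ, 0 < m → ∀ v : H,
      AEMeasurable (fun t => ENNReal.ofReal (t ^ (p - 1)) *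
        ENNReal.ofReal (quad (parallelSum t m A) v)) (ν.restrict (Ioi 0)) ∧
      ENNReal.ofReal (m ^ (1 - p) * quad (A ^ p) v) =
        ∫⁻ t in Ioi 0, ENNReal.ofReal (t ^ (p - 1)) *
          ENNReal.ofReal (quad (parallelSum t m A) v) ∂ν := by
  lift p to ℝ≥0 using hp.1.le
  obtain ⟨ν, hν⟩ := CFC.exists_measure_nnrpow_eq_integral_cfcₙ_rpowIntegrand₀₁ (A := H →L[ℂ] H)
    (p := p) ⟨by exact_mod_cast hp.1, by exact_mod_cast hp.2⟩
  refine ⟨ν, fun A hA m hm v => ?_⟩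
  have hsa : IsSelfAdjoint A := IsSelfAdjoint.of_nonneg hA
  obtain ⟨hint, heq⟩ := hν (m⁻¹ • A) (smul_nonneg (by positivity) hA)
  -- the real-linear functional `T ↦ m * Re ⟨v, T v⟩`
  let L : (H →L[ℂ] H) →L[ℝ] ℝ := m • (Complex.reCLM.comp
    (((innerSL ℂ v).comp (ContinuousLinearMap.apply ℂ H v)).restrictScalars ℝ))
  have hL : ∀ T, L T = m * quad T v := fun T => rfl
  have hker : ∀ t ∈ Ioi (0 : ℝ), L (cfcₙ (Real.rpowIntegrand₀₁ p t) (m⁻¹ • A)) =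
      t ^ ((p : ℝ) - 1) * quad (parallelSum t m A) v := by
    intro t ht
    have ht : 0 < t := ht
    have hc : 0 < t * m := by positivity
    have hcont := continuousOn_div_add hA hc (f := fun x => x * m) (by fun_prop)
    have h1 : m • cfcₙ (Real.rpowIntegrand₀₁ p t) (m⁻¹ • A) =
        t ^ ((p : ℝ) - 1) • parallelSum t m A := by
      have hf : ContinuousOn (Real.rpowIntegrand₀₁ p t) ((m⁻¹ • ·) '' spectrum ℝ A) := by
        refine (Real.continuousOn_rpowIntegrand₀₁_Ici hp ht).mono ?_
        rintro _ ⟨x, hx, rfl⟩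
        have := spectrum_nonneg_of_nonneg hA hx
        simp only [smul_eq_mul, mem_Ici]
        positivity
      have hf' : ContinuousOn (fun x => Real.rpowIntegrand₀₁ p t (m⁻¹ • x)) (spectrum ℝ A) :=
        hf.comp (by fun_prop) (mapsTo_image _ _)
      rw [cfcₙ_eq_cfc (hf := ?_) (hf0 := Real.rpowIntegrand₀₁_zero_right),
        ← cfc_comp_smul m⁻¹ _ A hf, ← cfc_smul m _ A hf', parallelSum, ← cfc_smul _ _ A hcont]
      · refine cfc_congr fun x hx => ?_
        have hx := spectrum_nonneg_of_nonneg hA hx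
        have h2 : x + t * m ≠ 0 := by positivity
        have h3 : t + m⁻¹ * x ≠ 0 := by positivity
        simp only [smul_eq_mul]
        rw [Real.rpowIntegrand₀₁_eq_pow_div hp ht.le (by positivity)]
        have h4 : t + m⁻¹ * x = (x + t * m) / m := by field_simp; ring
        rw [h4]
        field_simp
      · refine (Real.continuousOn_rpowIntegrand₀₁_Ici hp ht).mono ?_
        exact fun x hx => quasispectrum_nonneg_of_nonneg _ (smul_nonneg (by positivity) hA) x hx
    rw [hL, ← quad_smul, h1, quad_smul]
  have hval : m ^ (1 - (p : ℝ)) * quad (A ^ (p : ℝ)) v = L ((m⁻¹ • A) ^ p) := by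
    have h1 : (m⁻¹ • A) ^ p = (m⁻¹ ^ (p : ℝ)) • A ^ (p : ℝ) := by
      rw [CFC.nnrpow_eq_rpow (by exact_mod_cast hp.1), CFC.rpow_eq_cfc_real
        (smul_nonneg (by positivity) hA), CFC.rpow_eq_cfc_real hA, ← cfc_comp_smul m⁻¹ _ A
        (Real.continuous_rpow_const hp.1.le).continuousOn, ← cfc_smul _ _ A
        (Real.continuous_rpow_const hp.1.le).continuousOn]
      refine cfc_congr fun x hx => ?_
      have hx := spectrum_nonneg_of_nonneg hA hx
      simp only [smul_eq_mul]
      rw [Real.mul_rpow (by positivity) hx]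
    rw [hL, h1, quad_smul, ← mul_assoc, Real.rpow_sub hm, Real.rpow_one, Real.inv_rpow hm.le]
    rfl
  have hLint : Integrable (fun t => t ^ ((p : ℝ) - 1) * quad (parallelSum t m A) v)
      (ν.restrict (Ioi 0)) := by
    refine (L.integrable_comp hint).congr ?_
    filter_upwards [ae_restrict_mem measurableSet_Ioi] with t ht using hker t ht
  have hofr : ∀ t ∈ Ioi (0 : ℝ), ENNReal.ofReal (t ^ ((p : ℝ) - 1) * quad (parallelSum t m A) v) =
      ENNReal.ofReal (t ^ ((p : ℝ) - 1)) * ENNReal.ofReal (quad (parallelSum t m A) v) :=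
    fun t ht => ENNReal.ofReal_mul (Real.rpow_nonneg (le_of_lt ht) _)
  constructor
  · refine hLint.aemeasurable.ennreal_ofReal.congr ?_
    filter_upwards [ae_restrict_mem measurableSet_Ioi] with t ht using hofr t ht
  · rw [hval, heq, ← L.integral_comp_comm hint, setIntegral_congr_fun measurableSet_Ioi hker,
      ofReal_integral_eq_lintegral_ofReal hLint]
    · exact setLIntegral_congr_fun measurableSet_Ioi hofr
    · filter_upwards [ae_restrict_mem measurableSet_Ioi] with t ht
      exact mul_nonneg (Real.rpow_nonneg (le_of_lt ht) _)
        (quad_nonneg (parallelSum_nonneg hA ht hm.le) _)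

end

section

variable {H : Type u} [NormedAddCommGroup H] [InnerProductSpace ℂ H] [CompleteSpace H]

open MeasureTheory Set in
theorem exists_measure_liebTrace {p : ℝ} (hp : p ∈ Ioo (0 : ℝ) 1) :
    ∃ ν : Measure ℝ, ∀ {ι : Type u} {A Z : H →L[ℂ] H} (K : H →L[ℂ] H) {b : HilbertBasis ι ℂ H}
      {z : ι → ℝ≥0}, 0 ≤ A → 0 ≤ Z → trace Z ≠ ⊤ → IsEigenbasis Z b z →
      liebTrace p K A b z =
        ∫⁻ t in Ioi 0, ENNReal.ofReal (t ^ (p - 1)) * parallelTrace t K A b z ∂ν := by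
  obtain ⟨ν, hν⟩ := exists_measure_quad_rpow (H := H) hp
  refine ⟨ν, fun {ι A Z} K {b z} hA hZ hfin hb => ?_⟩
  -- the Hilbert space may be non-separable, but only countably many eigenvalues do not vanish
  have hcount : (Function.support z).Countable := by
    have h := hb.trace_eq hZ ▸ hfin
    refine (Summable.countable_support_ennreal h).mono fun j hj => ?_
    simpa using hj
  have := hcount.to_subtype
  have h1 : ∀ t, parallelTrace t K A b z = ∑' j : Function.support z,
      ENNReal.ofReal (quad (parallelSum t (z j) A) (K (b j))) := by
    intro t
    refine (tsum_subtype_eq_of_support_subset fun j hj => ?_).symm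
    contrapose! hj
    have hj : z j = 0 := by simpa using hj
    simp [hj, parallelSum, quad]
  have h2 : liebTrace p K A b z = ∑' j : Function.support z,
      ENNReal.ofReal ((z j : ℝ) ^ (1 - p) * quad (A ^ p) (K (b j))) := by
    refine (tsum_subtype_eq_of_support_subset fun j hj => ?_).symm
    contrapose! hj
    have hj : z j = 0 := by simpa using hj
    have : 1 - p ≠ 0 := by linarith [hp.2]
    simp [hj, Real.zero_rpow this]
  have hpos : ∀ j : Function.support z, 0 < (z j : ℝ) := fun j =>
    NNReal.coe_pos.2 (pos_iff_ne_zero.2 j.2)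
  rw [h2]
  simp only [h1, ← ENNReal.tsum_mul_left]
  rw [lintegral_tsum fun j => (hν A hA _ (hpos j) (K (b j))).1]
  exact tsum_congr fun j => (hν A hA _ (hpos j) (K (b j))).2

theorem liebTrace_one {ι : Type*} {A : H →L[ℂ] H} (hA : 0 ≤ A) (K : H →L[ℂ] H)
    (b : HilbertBasis ι ℂ H) (z : ι → ℝ≥0) : liebTrace 1 K A b z = trace (star K * A * K) := by
  rw [trace_conj_eq_tsum b hA]
  simp [liebTrace, CFC.rpow_one A hA]

/-- **Lieb's concavity theorem**: the map `(A, Z) ↦ tr (K* A ^ p K Z ^ (1 - p))` is jointly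
concave. -/
theorem liebTrace_concave {ι ι₁ ι₂ : Type u} {A₁ A₂ Z₁ Z₂ : H →L[ℂ] H} (hA₁ : 0 ≤ A₁)
    (hA₂ : 0 ≤ A₂) (hZ₁ : 0 ≤ Z₁) (hZ₂ : 0 ≤ Z₂) {a c : ℝ} (ha : 0 ≤ a) (hc : 0 ≤ c)
    (hfin₁ : trace Z₁ ≠ ⊤) (hfin₂ : trace Z₂ ≠ ⊤)
    {b₁ : HilbertBasis ι₁ ℂ H} {z₁ : ι₁ → ℝ≥0} (hb₁ : IsEigenbasis Z₁ b₁ z₁)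
    {b₂ : HilbertBasis ι₂ ℂ H} {z₂ : ι₂ → ℝ≥0} (hb₂ : IsEigenbasis Z₂ b₂ z₂)
    {b : HilbertBasis ι ℂ H} {z : ι → ℝ≥0} (hb : IsEigenbasis (a • Z₁ + c • Z₂) b z)
    {p : ℝ} (hp : 0 < p) (hp1 : p ≤ 1) (K : H →L[ℂ] H) :
    ENNReal.ofReal a * liebTrace p K A₁ b₁ z₁ + ENNReal.ofReal c * liebTrace p K A₂ b₂ z₂ ≤
      liebTrace p K (a • A₁ + c • A₂) b z := by
  have hA := nonneg_linear hA₁ hA₂ ha hc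
  have hZ := nonneg_linear hZ₁ hZ₂ ha hc
  have hfin : trace (a • Z₁ + c • Z₂) ≠ ⊤ := by
    rw [trace_linear hZ₁ hZ₂ ha hc]
    exact ENNReal.add_ne_top.2 ⟨ENNReal.mul_ne_top ENNReal.ofReal_ne_top hfin₁,
      ENNReal.mul_ne_top ENNReal.ofReal_ne_top hfin₂⟩
  rcases hp1.eq_or_lt with rfl | hp1
  · rw [liebTrace_one hA₁, liebTrace_one hA₂, liebTrace_one hA]
    have e1 : star K * (a • A₁ + c • A₂) * K = a • (star K * A₁ * K) + c • (star K * A₂ * K) := by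
      simp only [mul_add, add_mul, mul_smul_comm, smul_mul_assoc]
    rw [e1, trace_linear (star_left_conjugate_nonneg hA₁ K) (star_left_conjugate_nonneg hA₂ K)
      ha hc]
  · obtain ⟨ν, hν⟩ := exists_measure_liebTrace (H := H) ⟨hp, hp1⟩
    rw [hν K hA₁ hZ₁ hfin₁ hb₁, hν K hA₂ hZ₂ hfin₂ hb₂, hν K hA hZ hfin hb,
      ← MeasureTheory.lintegral_const_mul' _ _ ENNReal.ofReal_ne_top,
      ← MeasureTheory.lintegral_const_mul' _ _ ENNReal.ofReal_ne_top]
    refine (MeasureTheory.le_lintegral_add _ _).trans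
      (MeasureTheory.setLIntegral_mono' measurableSet_Ioi fun t ht => ?_)
    have h := parallelTrace_concave hA₁ hA₂ hZ₁ hZ₂ ha hc hfin hb₁ hb₂ hb ht K
    refine le_trans (le_of_eq ?_) (mul_le_mul_right h _)
    ring

end

/-! ### Trace inequalities of Epstein and Hölder -/

section

variable {H : Type u} [NormedAddCommGroup H] [InnerProductSpace ℂ H]

/-- The operator `∑ |uₖ⟩⟨uₖ|` over a finite set of indices. -/
noncomputable def gramSum {κ : Type*} (s : Finset κ) (u : κ → H) : H →L[ℂ] H :=
  ∑ k ∈ s, InnerProductSpace.rankOne ℂ (u k) (u k)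

theorem quad_gramSum {κ : Type*} (s : Finset κ) (u : κ → H) (v : H) :
    quad (gramSum s u) v = ∑ k ∈ s, ‖inner ℂ (u k) v‖ ^ 2 := by
  simp only [quad, gramSum, sum_apply, inner_sum, Complex.re_sum,
    InnerProductSpace.rankOne_apply, inner_smul_right]
  refine Finset.sum_congr rfl fun k _ => ?_
  rw [← inner_conj_symm v, Complex.mul_conj, Complex.ofReal_re, Complex.normSq_eq_norm_sq]

/-- If `|u⟩⟨u| ≤ M`, then `⟨u, M⁻¹ u⟩ ≤ 1`. -/
theorem tsum_norm_inner_sq_div_le_one {ι : Type*} {M : H →L[ℂ] H} {b : HilbertBasis ι ℂ H}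
    {m : ι → ℝ≥0} (hb : IsEigenbasis M b m) {u : H} (hu : ∀ v, ‖inner ℂ u v‖ ^ 2 ≤ quad M v) :
    ∑' j, ENNReal.ofReal (‖inner ℂ u (b j)‖ ^ 2 / m j) ≤ 1 := by
  rw [ENNReal.tsum_eq_iSup_sum]
  refine iSup_le fun J => ?_
  rw [← ENNReal.ofReal_sum_of_nonneg fun _ _ => by positivity, ENNReal.ofReal_le_one]
  set θ : ℝ := ∑ j ∈ J, ‖inner ℂ u (b j)‖ ^ 2 / m j with hθ
  -- test the hypothesis on the part of `M⁻¹ u` in the span of finitely many basis vectors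
  set y : H := ∑ j ∈ J, (inner ℂ (b j) u / ((m j : ℝ) : ℂ)) • b j with hy
  have h1 : inner ℂ u y = (θ : ℂ) := by
    rw [hy, inner_sum, hθ, Complex.ofReal_sum]
    refine Finset.sum_congr rfl fun j _ => ?_
    rw [inner_smul_right, ← inner_conj_symm (b j) u, div_mul_eq_mul_div, mul_comm, Complex.mul_conj,
      Complex.normSq_eq_norm_sq, Complex.ofReal_div]
  have h2 : quad M y = θ := by
    have hMy : M y = ∑ j ∈ J, (inner ℂ (b j) u / ((m j : ℝ) : ℂ) * ((m j : ℝ) : ℂ)) • b j := by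
      rw [hy, map_sum]
      refine Finset.sum_congr rfl fun j _ => ?_
      rw [map_smul, hb j, smul_smul]
    rw [quad, hMy, hy, b.orthonormal.inner_sum, Complex.re_sum, hθ]
    refine Finset.sum_congr rfl fun j _ => ?_
    rw [← mul_assoc, mul_comm (starRingEnd ℂ _), Complex.mul_conj, Complex.re_mul_ofReal,
      Complex.ofReal_re, Complex.normSq_eq_norm_sq, norm_div, Complex.norm_real, Real.norm_eq_abs,
      div_pow, sq_abs, norm_inner_symm]
    rcases eq_or_ne (m j : ℝ) 0 with h0 | h0
    · simp [h0]
    · field_simp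
  have h3 := hu y
  rw [h1, h2, Complex.norm_real, Real.norm_eq_abs, sq_abs] at h3
  by_contra! h4
  nlinarith

theorem mul_rpow_mul_le {r c m : ℝ} (hr : 1 ≤ r) (hc : 0 ≤ c) (hm : 0 ≤ m) :
    r * c ^ (r - 1) * m ≤ m ^ r + (r - 1) * c ^ r := by
  have hr0 : 0 < r := by linarith
  have hr1 : r⁻¹ ≤ 1 := inv_le_one_of_one_le₀ hr
  have h := Real.geom_mean_le_arith_mean2_weighted (w₁ := r⁻¹) (w₂ := 1 - r⁻¹) (p₁ := m ^ r)
    (p₂ := c ^ r) (by positivity) (by linarith) (by positivity) (by positivity) (by ring)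
  rw [← Real.rpow_mul hm, ← Real.rpow_mul hc, mul_inv_cancel₀ hr0.ne', Real.rpow_one,
    mul_sub, mul_inv_cancel₀ hr0.ne', mul_one] at h
  have h2 := mul_le_mul_of_nonneg_left h hr0.le
  refine le_trans (le_of_eq (by ring)) (h2.trans (le_of_eq ?_))
  field_simp

variable [CompleteSpace H]

theorem gramSum_nonneg {κ : Type*} (s : Finset κ) (u : κ → H) : 0 ≤ gramSum s u :=
  Finset.sum_nonneg fun _ _ => (ContinuousLinearMap.nonneg_iff_isPositive _).2
    (InnerProductSpace.isPositive_rankOne_self _)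

theorem trace_gramSum {κ : Type*} (s : Finset κ) (u : κ → H) :
    trace (gramSum s u) = ∑ k ∈ s, ENNReal.ofReal (‖u k‖ ^ 2) := by
  rw [trace_eq_tsum_quad (basis H) (gramSum_nonneg s u)]
  simp only [quad_gramSum]
  simp_rw [ENNReal.ofReal_sum_of_nonneg fun (i : κ) (_ : i ∈ s) =>
    (sq_nonneg ‖inner ℂ (u i) (basis H _)‖)]
  rw [Summable.tsum_finsetSum fun _ _ => ENNReal.summable]
  refine Finset.sum_congr rfl fun k _ => ?_
  rw [← tsum_ofReal_norm_sq (basis H)]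
  simp only [norm_inner_symm (u k)]

/-- Young's inequality `m ^ (1 - p) W ^ p ≤ (1 - p) m + p W` for an operator `W` and a scalar `m`. -/
theorem rpow_mul_quad_rpow_le {W : H →L[ℂ] H} (hW : 0 ≤ W) {p : ℝ} (hp : 0 < p) (hp1 : p ≤ 1)
    {m : ℝ} (hm : 0 ≤ m) {v : H} (hv : ‖v‖ = 1) :
    m ^ (1 - p) * quad (W ^ p) v ≤ (1 - p) * m + p * quad W v := by
  have hsa : IsSelfAdjoint W := IsSelfAdjoint.of_nonneg hW
  have hc : ContinuousOn (fun x : ℝ => x ^ p) (spectrum ℝ W) :=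
    (Real.continuous_rpow_const hp.le).continuousOn
  have h : m ^ (1 - p) • W ^ p ≤ ((1 - p) * m) • 1 + p • W := by
    rw [CFC.rpow_eq_cfc_real hW, ← cfc_smul _ _ W hc, ← Algebra.algebraMap_eq_smul_one,
      ← cfc_const _ W, ← cfc_const_mul_id p W, ← cfc_add (a := W) (fun _ => (1 - p) * m)
      (fun x => p * x)]
    refine cfc_mono (fun x hx => ?_) (hc.const_smul (m ^ (1 - p))) (by fun_prop)
    exact Real.geom_mean_le_arith_mean2_weighted (by linarith) hp.le hm
      (spectrum_nonneg_of_nonneg hW hx) (by ring)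
  have h1 := quad_mono h v
  have h2 : quad (1 : H →L[ℂ] H) v = 1 := by
    have : quad (1 : H →L[ℂ] H) v = ‖v‖ ^ 2 := inner_self_eq_norm_sq (𝕜 := ℂ) v
    rw [this, hv, one_pow]
  rwa [quad_smul, quad_add, quad_smul, quad_smul, h2, mul_one] at h1

theorem trace_le_liebTrace {ι : Type*} {A Z N : H →L[ℂ] H} (hZ : 0 ≤ Z) {b : HilbertBasis ι ℂ H}
    {z : ι → ℝ≥0} (hb : IsEigenbasis Z b z) {p : ℝ} (hp : 0 < p)
    (h : Z ^ p ≤ star N * A ^ p * N) : trace Z ≤ liebTrace p N A b z := by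
  rw [hb.trace_eq hZ]
  refine ENNReal.tsum_le_tsum fun j => ?_
  rw [← ENNReal.ofReal_coe_nnreal]
  refine ENNReal.ofReal_le_ofReal ?_
  have h1 := quad_mono h (b j)
  rw [hb.quad_rpow hZ hp.le, quad_conj] at h1
  refine le_trans (le_of_eq ?_) (mul_le_mul_of_nonneg_left h1 (Real.rpow_nonneg (z j).coe_nonneg _))
  rw [← Real.rpow_add' (z j).coe_nonneg (by norm_num), sub_add_cancel, Real.rpow_one]

/-- **Epstein's inequality**, in a form that avoids the powers `1 / p`: if
`Zᵢ ^ p ≤ N* σᵢ ^ p N` and `N* (a σ₁ + c σ₂) ^ p N ≤ W ^ p`, then `a tr Z₁ + c tr Z₂ ≤ tr W`. -/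
theorem trace_add_le_of_rpow_le {σ₁ σ₂ Z₁ Z₂ W N : H →L[ℂ] H} (hσ₁ : 0 ≤ σ₁) (hσ₂ : 0 ≤ σ₂)
    (hZ₁ : 0 ≤ Z₁) (hZ₂ : 0 ≤ Z₂) (hW : 0 ≤ W) {a c : ℝ} (ha : 0 ≤ a) (hc : 0 ≤ c)
    (hfin₁ : trace Z₁ ≠ ⊤) (hfin₂ : trace Z₂ ≠ ⊤) {p : ℝ} (hp : 0 < p) (hp1 : p ≤ 1)
    (h₁ : Z₁ ^ p ≤ star N * σ₁ ^ p * N) (h₂ : Z₂ ^ p ≤ star N * σ₂ ^ p * N)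
    (h : star N * (a • σ₁ + c • σ₂) ^ p * N ≤ W ^ p) :
    ENNReal.ofReal a * trace Z₁ + ENNReal.ofReal c * trace Z₂ ≤ trace W := by
  rcases eq_or_ne (trace W) ⊤ with hWtop | hWfin
  · simp [hWtop]
  have hZ := nonneg_linear hZ₁ hZ₂ ha hc
  have htr := trace_linear hZ₁ hZ₂ ha hc
  have hfin : trace (a • Z₁ + c • Z₂) ≠ ⊤ := by
    rw [htr]
    exact ENNReal.add_ne_top.2 ⟨ENNReal.mul_ne_top ENNReal.ofReal_ne_top hfin₁,
      ENNReal.mul_ne_top ENNReal.ofReal_ne_top hfin₂⟩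
  obtain ⟨ι₁, b₁, z₁, hb₁⟩ := exists_eigenbasis hZ₁ hfin₁
  obtain ⟨ι₂, b₂, z₂, hb₂⟩ := exists_eigenbasis hZ₂ hfin₂
  obtain ⟨ι, b, z, hb⟩ := exists_eigenbasis hZ hfin
  have hb : IsEigenbasis (a • Z₁ + c • Z₂) b z := hb
  have hlieb := liebTrace_concave hσ₁ hσ₂ hZ₁ hZ₂ ha hc hfin₁ hfin₂ hb₁ hb₂ hb hp hp1 N
  have hup : liebTrace p N (a • σ₁ + c • σ₂) b z ≤
      ENNReal.ofReal (1 - p) * trace (a • Z₁ + c • Z₂) + ENNReal.ofReal p * trace W := by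
    rw [hb.trace_eq hZ, trace_eq_tsum_quad b hW, ← ENNReal.tsum_mul_left, ← ENNReal.tsum_mul_left,
      ← ENNReal.tsum_add]
    refine ENNReal.tsum_le_tsum fun j => ?_
    have hq := quad_nonneg hW (b j)
    rw [← ENNReal.ofReal_coe_nnreal, ← ENNReal.ofReal_mul (by linarith),
      ← ENNReal.ofReal_mul hp.le, ← ENNReal.ofReal_add
      (mul_nonneg (by linarith) (NNReal.coe_nonneg _)) (by positivity)]
    refine ENNReal.ofReal_le_ofReal ?_
    refine le_trans (mul_le_mul_of_nonneg_left ?_ (Real.rpow_nonneg (z j).coe_nonneg _))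
      (rpow_mul_quad_rpow_le hW hp hp1 (z j).coe_nonneg (b.orthonormal.1 j))
    rw [← quad_conj]
    exact quad_mono h _
  have hlow : trace (a • Z₁ + c • Z₂) ≤ liebTrace p N (a • σ₁ + c • σ₂) b z := by
    rw [htr]
    refine le_trans (add_le_add (mul_le_mul_right ?_ _) (mul_le_mul_right ?_ _)) hlieb
    · exact trace_le_liebTrace hZ₁ hb₁ hp h₁
    · exact trace_le_liebTrace hZ₂ hb₂ hp h₂
  have hfinal := hlow.trans hup
  rw [← htr]
  clear hup hlow htr
  generalize trace (a • Z₁ + c • Z₂) = x at *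
  generalize trace W = w at *
  lift x to ℝ≥0 using hfin
  lift w to ℝ≥0 using hWfin
  rw [← ENNReal.ofReal_coe_nnreal, ← ENNReal.ofReal_coe_nnreal (p := w),
    ← ENNReal.ofReal_mul (by linarith), ← ENNReal.ofReal_mul hp.le, ← ENNReal.ofReal_add
      (mul_nonneg (by linarith) (NNReal.coe_nonneg _)) (by positivity),
    ENNReal.ofReal_le_ofReal_iff
      (add_nonneg (mul_nonneg (by linarith) (NNReal.coe_nonneg _)) (by positivity))] at hfinal
  have : p * (x : ℝ) ≤ p * w := by linarith
  exact_mod_cast le_of_mul_le_mul_left this hp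

/-- The diagonal of a Gram matrix is dominated by its eigenvalues:
`∑ ‖uₖ‖ ^ (2 r) ≤ tr (∑ |uₖ⟩⟨uₖ|) ^ r` for `r ≥ 1`. -/
theorem sum_norm_sq_rpow_le_trace {κ : Type*} (s : Finset κ) (u : κ → H) {r : ℝ} (hr : 1 ≤ r) :
    ∑ k ∈ s, ENNReal.ofReal ((‖u k‖ ^ 2) ^ r) ≤ trace (gramSum s u ^ r) := by
  have hM := gramSum_nonneg s u
  have hfin : trace (gramSum s u) ≠ ⊤ := by
    rw [trace_gramSum]
    exact ENNReal.sum_ne_top.2 fun _ _ => ENNReal.ofReal_ne_top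
  obtain ⟨ι, b, m, hb⟩ := exists_eigenbasis hM hfin
  have hb : IsEigenbasis (gramSum s u) b m := hb
  have hterm : ∀ k ∈ s, ∀ v, ‖inner ℂ (u k) v‖ ^ 2 ≤ quad (gramSum s u) v := by
    intro k hk v
    rw [quad_gramSum]
    exact Finset.single_le_sum (f := fun k => ‖inner ℂ (u k) v‖ ^ 2)
      (fun _ _ => by positivity) hk
  have hquad : ∀ j, quad (gramSum s u) (b j) = m j := by
    intro j
    rw [quad_eigenvector (hb j), b.orthonormal.1, one_pow, mul_one]
  have hk : ∀ k ∈ s, ENNReal.ofReal ((‖u k‖ ^ 2) ^ r) ≤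
      ∑' j, ENNReal.ofReal (‖inner ℂ (u k) (b j)‖ ^ 2 / m j * (m j : ℝ) ^ r) := by
    intro k hk
    set c := ‖u k‖ ^ 2 with hc
    have hc0 : 0 ≤ c := by positivity
    have hrc : 0 ≤ (r - 1) * c ^ r := mul_nonneg (by linarith) (Real.rpow_nonneg hc0 _)
    have h1 : ENNReal.ofReal (r * c ^ (r - 1)) * ENNReal.ofReal c ≤
        ∑' j, ENNReal.ofReal (‖inner ℂ (u k) (b j)‖ ^ 2 / m j * (m j : ℝ) ^ r) +
          ENNReal.ofReal ((r - 1) * c ^ r) * 1 := by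
      refine le_trans ?_ (add_le_add_right
        (mul_le_mul_right (tsum_norm_inner_sq_div_le_one hb (hterm k hk)) _) _)
      rw [hc, ← tsum_ofReal_norm_sq b, ← ENNReal.tsum_mul_left, ← ENNReal.tsum_mul_left,
        ← ENNReal.tsum_add]
      refine ENNReal.tsum_le_tsum fun j => ?_
      rw [← hc, ← ENNReal.ofReal_mul (by positivity), ← ENNReal.ofReal_mul hrc,
        ← ENNReal.ofReal_add (by positivity) (mul_nonneg hrc (by positivity))]
      refine ENNReal.ofReal_le_ofReal ?_
      have hq : ‖inner ℂ (b j) (u k)‖ ^ 2 = ‖inner ℂ (u k) (b j)‖ ^ 2 / m j * m j := by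
        rw [norm_inner_symm]
        rcases eq_or_ne (m j : ℝ) 0 with h0 | h0
        · have := hterm k hk (b j)
          rw [hquad, h0] at this
          rw [h0, mul_zero]
          exact le_antisymm this (by positivity)
        · field_simp
      rw [hq]
      have h2 := mul_le_mul_of_nonneg_left (mul_rpow_mul_le hr hc0 (m j).coe_nonneg)
        (show 0 ≤ ‖inner ℂ (u k) (b j)‖ ^ 2 / m j by positivity)
      linarith
    have h3 : ENNReal.ofReal (r * c ^ (r - 1)) * ENNReal.ofReal c =
        ENNReal.ofReal (c ^ r) + ENNReal.ofReal ((r - 1) * c ^ r) := by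
      rw [← ENNReal.ofReal_mul (by positivity), ← ENNReal.ofReal_add (by positivity) hrc]
      congr 1
      have : c ^ r = c ^ (r - 1) * c := by
        rw [← Real.rpow_add_one' hc0 (by linarith), sub_add_cancel]
      rw [this]
      ring
    rw [h3, mul_one] at h1
    exact (ENNReal.add_le_add_iff_right ENNReal.ofReal_ne_top).1 h1
  refine (Finset.sum_le_sum hk).trans ?_
  rw [← Summable.tsum_finsetSum fun _ _ => ENNReal.summable, hb.trace_rpow hM (by linarith)]
  refine ENNReal.tsum_le_tsum fun j => ?_
  rw [← ENNReal.ofReal_sum_of_nonneg fun _ _ => by positivity, ← Finset.sum_mul, ← Finset.sum_div,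
    ← quad_gramSum, hquad]
  refine ENNReal.ofReal_le_ofReal (mul_le_of_le_one_left (by positivity) (div_self_le_one _))

theorem le_of_quad_le {A B : H →L[ℂ] H} (hA : IsSelfAdjoint A) (hB : IsSelfAdjoint B)
    (h : ∀ x, quad A x ≤ quad B x) : A ≤ B := by
  rw [ContinuousLinearMap.le_def, ContinuousLinearMap.isPositive_def']
  refine ⟨hB.sub hA, fun x => ?_⟩
  have h1 : (inner ℂ ((B - A) x) x).re = quad B x - quad A x := by
    rw [← inner_conj_symm, Complex.conj_re, sub_apply, inner_sub_right, Complex.sub_re]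
    rfl
  have h2 := sub_nonneg.2 (h x)
  rw [← h1] at h2
  exact h2

theorem gramSum_star_le {κ : Type*} {h : κ → H} (hh : Orthonormal ℂ h) (s : Finset κ)
    (X : H →L[ℂ] H) : gramSum s (fun k => star X (h k)) ≤ star X * X := by
  refine le_of_quad_le (IsSelfAdjoint.of_nonneg (gramSum_nonneg _ _))
    (IsSelfAdjoint.star_mul_self X) fun v => ?_
  rw [quad_gramSum, quad_star_mul_self]
  simp only [inner_star_apply]
  exact hh.sum_inner_products_le (X v)

/-- **Hölder's inequality** for the product `X Y`, tested on finite orthonormal families. -/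
theorem sum_norm_inner_rpow_le {κ : Type*} {h e : κ → H} (he : Orthonormal ℂ e) (s : Finset κ)
    (X Y : H →L[ℂ] H) {α : ℝ} (hα : 1 / 2 ≤ α) (hα1 : α < 1) :
    ∑ k ∈ s, ENNReal.ofReal ((‖inner ℂ (h k) (X (Y (e k)))‖ ^ 2) ^ α) ≤
      ENNReal.ofReal α * trace (star Y * Y) +
        ENNReal.ofReal (1 - α) * trace (gramSum s (fun k => star X (h k)) ^ (α / (1 - α))) := by
  have h1α : 0 < 1 - α := by linarith
  have hr : 1 ≤ α / (1 - α) := by rw [le_div_iff₀ h1α]; linarith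
  refine le_trans ?_ (add_le_add (mul_le_mul_right (sum_norm_sq_le_trace he s Y) _)
    (mul_le_mul_right (sum_norm_sq_rpow_le_trace s (fun k => star X (h k)) hr) _))
  rw [Finset.mul_sum, Finset.mul_sum, ← Finset.sum_add_distrib]
  refine Finset.sum_le_sum fun k _ => ?_
  rw [← ENNReal.ofReal_mul (by linarith), ← ENNReal.ofReal_mul h1α.le,
    ← ENNReal.ofReal_add (by positivity) (by positivity)]
  refine ENNReal.ofReal_le_ofReal ?_
  refine le_trans ?_ (Real.geom_mean_le_arith_mean2_weighted (by linarith : 0 ≤ α) h1α.le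
    (sq_nonneg ‖Y (e k)‖) (Real.rpow_nonneg (sq_nonneg ‖star X (h k)‖) _) (by ring))
  rw [← Real.rpow_mul (by positivity), div_mul_cancel₀ _ h1α.ne',
    ← Real.mul_rpow (by positivity) (by positivity), ← mul_pow, mul_comm ‖Y (e k)‖]
  refine Real.rpow_le_rpow (by positivity) ?_ (by linarith)
  refine pow_le_pow_left₀ (norm_nonneg _) ?_ 2
  rw [← inner_star_apply]
  exact norm_inner_le_norm _ _

end

/-! ### Joint concavity of the sandwiched trace -/

section

variable {H : Type u} [NormedAddCommGroup H] [InnerProductSpace ℂ H] [CompleteSpace H]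

theorem rpow_mul_rpow {A : H →L[ℂ] H} (hA : 0 ≤ A) {x y : ℝ} (hx : 0 < x) (hy : 0 < y) :
    A ^ x * A ^ y = A ^ (x + y) := by
  rw [CFC.rpow_eq_cfc_real hA, CFC.rpow_eq_cfc_real hA, CFC.rpow_eq_cfc_real hA,
    ← cfc_mul _ _ A (Real.continuous_rpow_const hx.le).continuousOn
      (Real.continuous_rpow_const hy.le).continuousOn]
  refine cfc_congr fun t ht => ?_
  exact (Real.rpow_add' (spectrum_nonneg_of_nonneg hA ht) (by positivity)).symm

theorem smul_rpow {A : H →L[ℂ] H} (hA : 0 ≤ A) {a p : ℝ} (ha : 0 ≤ a) (hp : 0 ≤ p) :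
    (a • A) ^ p = a ^ p • A ^ p := by
  have hc : ContinuousOn (fun x : ℝ => x ^ p) (spectrum ℝ A) :=
    (Real.continuous_rpow_const hp).continuousOn
  have hsa : IsSelfAdjoint A := IsSelfAdjoint.of_nonneg hA
  rw [CFC.rpow_eq_cfc_real (smul_nonneg ha hA), CFC.rpow_eq_cfc_real hA, ← cfc_comp_smul a _ A
    (Real.continuous_rpow_const hp).continuousOn, ← cfc_smul _ _ A hc]
  refine cfc_congr fun x hx => ?_
  simp only [smul_eq_mul]
  rw [Real.mul_rpow ha (spectrum_nonneg_of_nonneg hA hx)]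

theorem continuousOn_add_rpow {M : H →L[ℂ] H} (hM : 0 ≤ M) {η : ℝ} (hη : 0 < η) (γ : ℝ) :
    ContinuousOn (fun x => (x + η) ^ γ) (spectrum ℝ M) := by
  refine ContinuousOn.rpow_const (by fun_prop) fun x hx => Or.inl ?_
  have := spectrum_nonneg_of_nonneg hM hx
  positivity

theorem rpow_mul_cfc_add_rpow {M : H →L[ℂ] H} (hM : 0 ≤ M) {η γ : ℝ} (hη : 0 < η) (hγ : 0 < γ) :
    M ^ γ * cfc (fun x => (x + η) ^ (-γ)) M = cfc (fun x => (x / (x + η)) ^ γ) M := by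
  rw [CFC.rpow_eq_cfc_real hM, ← cfc_mul _ _ M (Real.continuous_rpow_const hγ.le).continuousOn
    (continuousOn_add_rpow hM hη _)]
  refine cfc_congr fun x hx => ?_
  have hx := spectrum_nonneg_of_nonneg hM hx
  rw [Real.rpow_neg (by positivity), Real.div_rpow hx (by positivity), div_eq_mul_inv]

/-- If `B B* ≤ κ M`, then the approximate inverses `(M + η) ^ (-γ)` of `M ^ γ` invert it on the range
of `B` in the limit `η → 0`. -/
theorem norm_rpow_mul_cfc_sub_sq_le {M B : H →L[ℂ] H} (hM : 0 ≤ M) {κ : ℝ} (hκ : 0 ≤ κ)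
    (hB : B * star B ≤ κ • M) {η γ : ℝ} (hη : 0 < η) (hγ : 0 < γ) (hγ1 : γ ≤ 1) :
    ‖M ^ γ * cfc (fun x => (x + η) ^ (-γ)) M * B - B‖ ^ 2 ≤ κ * η := by
  have hsa : IsSelfAdjoint M := IsSelfAdjoint.of_nonneg hM
  have hc1 : ContinuousOn (fun x => (x / (x + η)) ^ γ) (spectrum ℝ M) :=
    (continuousOn_div_add hM hη (f := fun x => x) continuous_id).rpow_const
      fun x _ => Or.inr hγ.le
  set f : ℝ → ℝ := fun x => (x / (x + η)) ^ γ - 1 with hf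
  have hfc : ContinuousOn f (spectrum ℝ M) := hc1.sub continuousOn_const
  have hfsa : IsSelfAdjoint (cfc f M) := cfc_predicate _ _
  have h1 : M ^ γ * cfc (fun x => (x + η) ^ (-γ)) M * B - B = cfc f M * B := by
    rw [rpow_mul_cfc_add_rpow hM hη hγ, hf, cfc_sub _ (fun _ => (1 : ℝ)) M hc1 continuousOn_const,
      cfc_const_one ℝ M, sub_mul, one_mul]
  have h2 : cfc f M * B * star (cfc f M * B) ≤ κ • cfc (fun x => f x * x * f x) M := by
    have : cfc (fun x => f x * x * f x) M = cfc f M * M * star (cfc f M) := by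
      rw [cfc_mul (fun x => f x * x) f M (hfc.mul continuousOn_id) hfc,
        cfc_mul f (fun x => x) M hfc continuousOn_id, cfc_id' ℝ M, hfsa.star_eq]
    rw [this, star_mul, mul_assoc, ← mul_assoc B, ← mul_assoc]
    refine (star_right_conjugate_le_conjugate hB (cfc f M)).trans (le_of_eq ?_)
    rw [mul_smul_comm, smul_mul_assoc]
  have hfc2 : ContinuousOn (fun x => f x * x * f x) (spectrum ℝ M) :=
    (hfc.mul continuousOn_id).mul hfc
  have h3 : κ • cfc (fun x => f x * x * f x) M ≤ algebraMap ℝ (H →L[ℂ] H) (κ * η) := by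
    rw [← cfc_smul κ _ M hfc2, ← cfc_const (κ * η) M]
    refine cfc_mono (fun x hx => ?_) (hfc2.const_smul κ) continuousOn_const
    have hx := spectrum_nonneg_of_nonneg hM hx
    refine mul_le_mul_of_nonneg_left ?_ hκ
    have e0 : 0 ≤ x / (x + η) := by positivity
    have e1 : x / (x + η) ≤ 1 := by rw [div_le_one (by positivity)]; linarith
    have e2 : x / (x + η) ≤ (x / (x + η)) ^ γ := by
      simpa using Real.rpow_le_rpow_of_exponent_ge' e0 e1 hγ.le hγ1
    have e3 : (x / (x + η)) ^ γ ≤ 1 := Real.rpow_le_one e0 e1 hγ.le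
    have e4 : x * (1 - x / (x + η)) ≤ η := by
      have : x * (1 - x / (x + η)) = x / (x + η) * η := by field_simp; ring
      rw [this]
      nlinarith
    simp only [hf]
    nlinarith [mul_nonneg hx (sub_nonneg.2 e3), mul_nonneg hx (sub_nonneg.2 e2),
      mul_nonneg (mul_nonneg hx (sub_nonneg.2 e3)) (e0.trans e2)]
  rw [h1, sq, ← CStarRing.norm_self_mul_star]
  exact (CStarAlgebra.norm_le_iff_le_algebraMap _ (by positivity) (mul_star_self_nonneg _)).2
    (h2.trans h3)

theorem tendsto_rpow_mul_cfc_mul {M B : H →L[ℂ] H} (hM : 0 ≤ M) {κ : ℝ} (hκ : 0 ≤ κ)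
    (hB : B * star B ≤ κ • M) {γ : ℝ} (hγ : 0 < γ) (hγ1 : γ ≤ 1) :
    Filter.Tendsto (fun η : ℝ => M ^ γ * cfc (fun x => (x + η) ^ (-γ)) M * B)
      (nhdsWithin 0 (Set.Ioi 0)) (nhds B) := by
  rw [tendsto_iff_norm_sub_tendsto_zero]
  have h0 : Filter.Tendsto (fun η : ℝ => √(κ * η)) (nhdsWithin 0 (Set.Ioi 0)) (nhds 0) := by
    have : Continuous fun η : ℝ => √(κ * η) := by fun_prop
    simpa [ContinuousWithinAt] using this.continuousWithinAt (s := Set.Ioi 0) (x := 0)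
  refine squeeze_zero' (Filter.Eventually.of_forall fun _ => norm_nonneg _) ?_ h0
  filter_upwards [self_mem_nhdsWithin] with η hη
  exact Real.le_sqrt_of_sq_le (norm_rpow_mul_cfc_sub_sq_le hM hκ hB hη hγ hγ1)

theorem trace_rpow_ne_top {M : H →L[ℂ] H} (hM : 0 ≤ M) (hfin : trace M ≠ ⊤) {r : ℝ} (hr : 1 ≤ r) :
    trace (M ^ r) ≠ ⊤ := by
  obtain ⟨ι, b, m, hb⟩ := exists_eigenbasis hM hfin
  have hb : IsEigenbasis M b m := hb
  obtain ⟨S, hS, hle⟩ : ∃ S : ℝ, 0 ≤ S ∧ ∀ j, (m j : ℝ) ≤ S := by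
    refine ⟨(trace M).toReal, ENNReal.toReal_nonneg, fun j => ?_⟩
    have h1 : (m j : ℝ≥0∞) ≤ trace M := by
      rw [hb.trace_eq hM]
      exact ENNReal.le_tsum j
    exact (ENNReal.toReal_mono hfin h1 :)
  refine ne_top_of_le_ne_top (b := ENNReal.ofReal (S ^ (r - 1)) * trace M)
    (ENNReal.mul_ne_top ENNReal.ofReal_ne_top hfin) ?_
  rw [hb.trace_rpow hM (by linarith), hb.trace_eq hM, ← ENNReal.tsum_mul_left]
  refine ENNReal.tsum_le_tsum fun j => ?_
  rw [← ENNReal.ofReal_coe_nnreal, ← ENNReal.ofReal_mul (by positivity)]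
  refine ENNReal.ofReal_le_ofReal ?_
  have : (m j : ℝ) ^ r = (m j : ℝ) ^ (r - 1) * m j := by
    rw [← Real.rpow_add_one' (m j).coe_nonneg (by linarith), sub_add_cancel]
  rw [this]
  exact mul_le_mul_of_nonneg_right (Real.rpow_le_rpow (m j).coe_nonneg (hle j) (by linarith))
    (m j).coe_nonneg

/-- The singular value decomposition of a Hilbert–Schmidt operator, and the trace of the powers of
its absolute value. -/
theorem exists_singular_vectors {B : H →L[ℂ] H} (hfin : trace (B * star B) ≠ ⊤) {α : ℝ}
    (hα : 0 < α) :
    ∃ (κ : Type u) (h e : κ → H), Orthonormal ℂ h ∧ Orthonormal ℂ e ∧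
      trace ((B * star B) ^ α) = ∑' k, ENNReal.ofReal ((‖inner ℂ (h k) (B (e k))‖ ^ 2) ^ α) := by
  have hBB := mul_star_self_nonneg B
  obtain ⟨ι, b, z, hb⟩ := exists_eigenbasis hBB hfin
  have hb : IsEigenbasis (B * star B) b z := hb
  have hz : ∀ k : Function.support z, 0 < (z k : ℝ) := fun k =>
    NNReal.coe_pos.2 (pos_iff_ne_zero.2 k.2)
  classical
  have hinner : ∀ k l : Function.support z, inner ℂ (star B (b k)) (star B (b l)) =
      if (k : ι) = l then ((z l : ℝ) : ℂ) else 0 := by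
    intro k l
    rw [inner_star_apply, ← mul_apply_eq_comp, hb l, inner_smul_right,
      orthonormal_iff_ite.1 b.orthonormal]
    split_ifs <;> simp
  refine ⟨Function.support z, fun k => b k, fun k => ((√(z k))⁻¹ : ℂ) • star B (b k),
    b.orthonormal.comp _ Subtype.val_injective, ?_, ?_⟩
  · rw [orthonormal_iff_ite]
    intro k l
    rw [inner_smul_left, inner_smul_right, hinner]
    by_cases hkl : k = l
    · subst hkl
      rw [if_pos rfl, if_pos rfl, map_inv₀, Complex.conj_ofReal, ← mul_assoc, ← Complex.ofReal_inv,
        ← Complex.ofReal_mul, ← Complex.ofReal_mul, ← mul_inv, Real.mul_self_sqrt (hz k).le,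
        inv_mul_cancel₀ (hz k).ne', Complex.ofReal_one]
    · rw [if_neg fun h => hkl (Subtype.ext h), if_neg hkl, mul_zero, mul_zero]
  · rw [hb.trace_rpow hBB hα.le, ← tsum_subtype_eq_of_support_subset (s := Function.support z)]
    · refine tsum_congr fun k => ?_
      congr 2
      have h1 : inner ℂ (b k) (B (star B (b k))) = ((z k : ℝ) : ℂ) := by
        rw [← inner_star_apply, hinner, if_pos rfl]
      rw [map_smul, inner_smul_right, h1, ← Complex.ofReal_inv, ← Complex.ofReal_mul,
        Complex.norm_real, Real.norm_eq_abs, sq_abs, mul_pow, inv_pow, Real.sq_sqrt (hz k).le]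
      have := (hz k).ne'
      field_simp
    · intro j hj
      contrapose! hj
      have hj : z j = 0 := by simpa using hj
      simp [hj, Real.zero_rpow hα.ne']

end

section

variable {H : Type u} [NormedAddCommGroup H] [InnerProductSpace ℂ H] [CompleteSpace H]

theorem sqrt_conj_eq {ρ S : H →L[ℂ] H} (hρ : 0 ≤ ρ) (hS : IsSelfAdjoint S) :
    (S * CFC.sqrt ρ) * star (S * CFC.sqrt ρ) = S * ρ * S := by
  have h : IsSelfAdjoint (CFC.sqrt ρ) := IsSelfAdjoint.of_nonneg (CFC.sqrt_nonneg ρ)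
  rw [star_mul, h.star_eq, hS.star_eq, ← mul_assoc, mul_assoc S, CFC.sqrt_mul_sqrt_self ρ]

theorem trace_smul {A : H →L[ℂ] H} (hA : 0 ≤ A) {a : ℝ} (ha : 0 ≤ a) :
    trace (a • A) = ENNReal.ofReal a * trace A := by
  have := trace_linear hA hA ha le_rfl
  simpa using this

theorem trace_sandwich_ne_top {ρ S : H →L[ℂ] H} (hρ : 0 ≤ ρ) (hfin : trace ρ ≠ ⊤)
    (hS : IsSelfAdjoint S) : trace (S * ρ * S) ≠ ⊤ := by
  have h : IsSelfAdjoint (CFC.sqrt ρ) := IsSelfAdjoint.of_nonneg (CFC.sqrt_nonneg ρ)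
  rw [← sqrt_conj_eq hρ hS, ← trace_star_mul_self_comm]
  have h1 : star (S * CFC.sqrt ρ) * (S * CFC.sqrt ρ) ≤ ‖S * S‖ • ρ := by
    have h2 := CStarAlgebra.star_left_conjugate_le_norm_smul (a := CFC.sqrt ρ) (b := S * S)
      (hb := hS.mul_self_nonneg.isSelfAdjoint)
    rw [h.star_eq, CFC.sqrt_mul_sqrt_self ρ] at h2
    rwa [star_mul, h.star_eq, hS.star_eq, ← mul_assoc, mul_assoc (CFC.sqrt ρ)]
  refine ne_top_of_le_ne_top ?_ (trace_mono h1)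
  rw [trace_smul hρ (norm_nonneg _)]
  exact ENNReal.mul_ne_top ENNReal.ofReal_ne_top hfin

/-- The power `Z = G ^ r` of the Gram operator `G` of finitely many vectors
`(σ ^ (p / 2) N)* hₖ`, with `r p = 1`, satisfies `Z ^ p ≤ N* σ ^ p N` and has finite trace, as
Epstein's inequality requires. Finite families suffice for the Hölder estimate, and for them no assumption on
the trace of `σ` is needed. -/
theorem gramSum_rpow_spec {σ : H →L[ℂ] H} (hσ : 0 ≤ σ) {κ : Type*} {h : κ → H}
    (hh : Orthonormal ℂ h) (s : Finset κ) (N : H →L[ℂ] H) {p r : ℝ} (hp : 0 < p) (hr : 1 ≤ r)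
    (hrp : r * p = 1) :
    0 ≤ gramSum s (fun k => star (σ ^ (p / 2) * N) (h k)) ^ r ∧
      trace (gramSum s (fun k => star (σ ^ (p / 2) * N) (h k)) ^ r) ≠ ⊤ ∧
      (gramSum s (fun k => star (σ ^ (p / 2) * N) (h k)) ^ r) ^ p ≤ star N * σ ^ p * N := by
  have hM := gramSum_nonneg s (fun k => star (σ ^ (p / 2) * N) (h k))
  refine ⟨CFC.rpow_nonneg, trace_rpow_ne_top hM ?_ hr, ?_⟩
  · rw [trace_gramSum]
    exact ENNReal.sum_ne_top.2 fun _ _ => ENNReal.ofReal_ne_top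
  · rw [CFC.rpow_rpow_of_exponent_nonneg _ r p (by linarith) hp.le, hrp, CFC.rpow_one _ hM]
    refine (gramSum_star_le hh s _).trans (le_of_eq ?_)
    have hsa : IsSelfAdjoint (σ ^ (p / 2)) := IsSelfAdjoint.of_nonneg CFC.rpow_nonneg
    rw [star_mul, hsa.star_eq, ← mul_assoc, mul_assoc (star N),
      rpow_mul_rpow hσ (by linarith) (by linarith), add_halves]

/-- The key estimate. Here `N K` is an approximate identity built from `A = a σ₁ + c σ₂` and
`R = a ρ₁ + c ρ₂`, with the sandwiched operator `T` of `A` and `R`: Hölder's inequality separates the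
factors `σᵢ ^ (p / 2) N` and `K ρᵢ ^ (1 / 2)`. The traces of the former are controlled by Epstein's
inequality, those of the latter are affine in `ρᵢ`. -/
theorem sum_add_sum_le_trace {ρ₁ ρ₂ σ₁ σ₂ T N K : H →L[ℂ] H} (hρ₁ : 0 ≤ ρ₁) (hρ₂ : 0 ≤ ρ₂)
    (hσ₁ : 0 ≤ σ₁) (hσ₂ : 0 ≤ σ₂) {a c : ℝ} (ha : 0 ≤ a) (hc : 0 ≤ c) {α p : ℝ}
    (hα : 1 / 2 ≤ α) (hα1 : α < 1) (hp : p = (1 - α) / α) (hT : 0 ≤ T)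
    (hN : star N * (a • σ₁ + c • σ₂) ^ p * N ≤ T ^ (1 - α))
    (hK : K * (a • ρ₁ + c • ρ₂) * star K ≤ T ^ α)
    {κ₁ κ₂ : Type*} {h₁ e₁ : κ₁ → H} {h₂ e₂ : κ₂ → H} (hh₁ : Orthonormal ℂ h₁)
    (he₁ : Orthonormal ℂ e₁) (hh₂ : Orthonormal ℂ h₂) (he₂ : Orthonormal ℂ e₂)
    (s₁ : Finset κ₁) (s₂ : Finset κ₂) :
    ENNReal.ofReal a * ∑ k ∈ s₁, ENNReal.ofReal
        ((‖inner ℂ (h₁ k) ((σ₁ ^ (p / 2) * N * (K * CFC.sqrt ρ₁)) (e₁ k))‖ ^ 2) ^ α) +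
      ENNReal.ofReal c * ∑ k ∈ s₂, ENNReal.ofReal
        ((‖inner ℂ (h₂ k) ((σ₂ ^ (p / 2) * N * (K * CFC.sqrt ρ₂)) (e₂ k))‖ ^ 2) ^ α) ≤
      trace (T ^ α) := by
  have hα0 : 0 < α := by linarith
  have h1α : 0 < 1 - α := by linarith
  have hp0 : 0 < p := hp ▸ by positivity
  have hp1 : p ≤ 1 := by rw [hp, div_le_one hα0]; linarith
  have hr : 1 ≤ α / (1 - α) := by rw [le_div_iff₀ h1α]; linarith
  have hrp : α / (1 - α) * p = 1 := by rw [hp]; field_simp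
  obtain ⟨hZ₁, hZfin₁, hZp₁⟩ := gramSum_rpow_spec hσ₁ hh₁ s₁ N hp0 hr hrp
  obtain ⟨hZ₂, hZfin₂, hZp₂⟩ := gramSum_rpow_spec hσ₂ hh₂ s₂ N hp0 hr hrp
  have hW : (T ^ α) ^ p = T ^ (1 - α) := by
    rw [CFC.rpow_rpow_of_exponent_nonneg T α p hα0.le hp0.le, hp]
    congr 1
    field_simp
  have hepstein := trace_add_le_of_rpow_le hσ₁ hσ₂ hZ₁ hZ₂ (W := T ^ α) CFC.rpow_nonneg ha hc
    hZfin₁ hZfin₂ hp0 hp1 hZp₁ hZp₂ (hW ▸ hN)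
  have hY : ∀ ρ : H →L[ℂ] H, 0 ≤ ρ →
      trace (star (K * CFC.sqrt ρ) * (K * CFC.sqrt ρ)) = trace (K * ρ * star K) := by
    intro ρ hρ
    have h : IsSelfAdjoint (CFC.sqrt ρ) := IsSelfAdjoint.of_nonneg (CFC.sqrt_nonneg ρ)
    rw [trace_star_mul_self_comm, star_mul, h.star_eq, ← mul_assoc, mul_assoc K,
      CFC.sqrt_mul_sqrt_self ρ]
  have haffine : ENNReal.ofReal a * trace (K * ρ₁ * star K) +
      ENNReal.ofReal c * trace (K * ρ₂ * star K) ≤ trace (T ^ α) := by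
    rw [← trace_linear (star_right_conjugate_nonneg hρ₁ K) (star_right_conjugate_nonneg hρ₂ K)
      ha hc]
    refine trace_mono (le_trans (le_of_eq ?_) hK)
    simp only [mul_add, add_mul, mul_smul_comm, smul_mul_assoc]
  have hx₁ := sum_norm_inner_rpow_le (h := h₁) he₁ s₁ (σ₁ ^ (p / 2) * N) (K * CFC.sqrt ρ₁) hα hα1
  have hx₂ := sum_norm_inner_rpow_le (h := h₂) he₂ s₂ (σ₂ ^ (p / 2) * N) (K * CFC.sqrt ρ₂) hα hα1
  rw [hY ρ₁ hρ₁] at hx₁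
  rw [hY ρ₂ hρ₂] at hx₂
  refine (add_le_add (mul_le_mul_right hx₁ _) (mul_le_mul_right hx₂ _)).trans ?_
  have hsum := add_le_add (mul_le_mul_right haffine (ENNReal.ofReal α))
    (mul_le_mul_right hepstein (ENNReal.ofReal (1 - α)))
  rw [← add_mul, ← ENNReal.ofReal_add hα0.le h1α.le, add_sub_cancel, ENNReal.ofReal_one,
    one_mul] at hsum
  refine le_trans (le_of_eq ?_) hsum
  ring

theorem conj_cfc_add_rpow_le {M : H →L[ℂ] H} (hM : 0 ≤ M) {η γ : ℝ} (hη : 0 < η) (hγ : 0 < γ)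
    (hγ1 : 2 * γ ≤ 1) :
    cfc (fun x => (x + η) ^ (-γ)) M * M * cfc (fun x => (x + η) ^ (-γ)) M ≤ M ^ (1 - 2 * γ) := by
  have hsa : IsSelfAdjoint M := IsSelfAdjoint.of_nonneg hM
  have hc := continuousOn_add_rpow hM hη (-γ)
  rw [CFC.rpow_eq_cfc_real hM]
  nth_rw 2 [← cfc_id' ℝ M]
  have hc2 : ContinuousOn (fun x => (x + η) ^ (-γ) * x) (spectrum ℝ M) := hc.mul continuousOn_id
  rw [← cfc_mul _ (fun x => x) M hc continuousOn_id, ← cfc_mul _ _ M hc2 hc]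
  refine cfc_mono (fun x hx => ?_) (hc2.mul hc)
    (Real.continuous_rpow_const (by linarith)).continuousOn
  rcases (spectrum_nonneg_of_nonneg hM hx).eq_or_lt with rfl | hx
  · simpa using Real.rpow_nonneg le_rfl _
  · have h1 : (x + η) ^ (-γ) ≤ x ^ (-γ) :=
      Real.rpow_le_rpow_of_nonpos hx (by linarith) (by linarith)
    have h2 : x ^ (1 - 2 * γ) = x ^ (-γ) * x * x ^ (-γ) := by
      rw [← Real.rpow_add_one hx.ne', ← Real.rpow_add hx]
      congr 1
      ring
    rw [h2]
    have h3 : 0 ≤ (x + η) ^ (-γ) := by positivity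
    gcongr

theorem continuous_sum_norm_inner_rpow {κ : Type*} (h e : κ → H) (s : Finset κ) {α : ℝ}
    (hα : 0 ≤ α) :
    Continuous fun V : H →L[ℂ] H =>
      ∑ k ∈ s, ENNReal.ofReal ((‖inner ℂ (h k) (V (e k))‖ ^ 2) ^ α) := by
  refine continuous_finsetSum _ fun k _ => ENNReal.continuous_ofReal.comp ?_
  refine Continuous.rpow_const ?_ fun _ => Or.inr hα
  fun_prop

/-- The identity `T ^ γ T ^ (-γ) S ρ ^ (1 / 2) = S ρ ^ (1 / 2)`, as a limit of regularized inverse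
powers of `T = S R S`. The range condition behind it follows from `ρ ≤ κ R`. -/
theorem tendsto_sandwich_sqrt {R ρ S T V : H →L[ℂ] H} (hR : 0 ≤ R) (hρ : 0 ≤ ρ)
    (hS : IsSelfAdjoint S) (hT : T = S * R * S) {κ : ℝ} (hκ : 0 ≤ κ) (hle : ρ ≤ κ • R) {γ : ℝ}
    (hγ : 0 < γ) (hγ1 : γ ≤ 1) :
    Filter.Tendsto (fun η : ℝ => V * T ^ γ * (cfc (fun x => (x + η) ^ (-γ)) T * S * CFC.sqrt ρ))
      (nhdsWithin 0 (Set.Ioi 0)) (nhds (V * S * CFC.sqrt ρ)) := by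
  have hT0 : 0 ≤ T := hT ▸ hS.conjugate_nonneg hR
  have h1 : S * CFC.sqrt ρ * star (S * CFC.sqrt ρ) ≤ κ • T := by
    rw [sqrt_conj_eq hρ hS, hT]
    refine (hS.conjugate_le_conjugate hle).trans (le_of_eq ?_)
    rw [mul_smul_comm, smul_mul_assoc]
  have h2 := (tendsto_rpow_mul_cfc_mul hT0 hκ h1 hγ hγ1).const_mul V
  simpa only [mul_assoc] using h2

/-- The identity `σ ^ (p / 2) A ^ (-p / 2) A ^ (p / 2) = σ ^ (p / 2)`, as a limit of regularized inverse
powers of `A`. It holds as `σ ≤ κ A` implies `σ ^ p ≤ κ ^ p A ^ p`. -/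
theorem tendsto_rpow_half_mul {A σ B : H →L[ℂ] H} (hA : 0 ≤ A) (hσ : 0 ≤ σ) {κ p : ℝ} (hκ : 0 ≤ κ)
    (hle : σ ≤ κ • A) (hp : 0 < p) (hp1 : p ≤ 1) :
    Filter.Tendsto (fun δ : ℝ => σ ^ (p / 2) * cfc (fun x => (x + δ) ^ (-(1 / 2 : ℝ))) (A ^ p) *
      A ^ (p / 2) * B) (nhdsWithin 0 (Set.Ioi 0)) (nhds (σ ^ (p / 2) * B)) := by
  have hsa : ∀ σ : H →L[ℂ] H, IsSelfAdjoint (σ ^ (p / 2)) := fun σ =>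
    IsSelfAdjoint.of_nonneg CFC.rpow_nonneg
  have h1 : σ ^ (p / 2) * star (σ ^ (p / 2)) ≤ (κ ^ p) • A ^ p := by
    rw [(hsa σ).star_eq, rpow_mul_rpow hσ (by linarith) (by linarith), add_halves,
      ← smul_rpow hA hκ hp.le]
    exact CFC.rpow_le_rpow ⟨hp.le, hp1⟩ hle
  have hM : 0 ≤ A ^ p := CFC.rpow_nonneg
  have hM2 : (A ^ p) ^ (1 / 2 : ℝ) = A ^ (p / 2) := by
    rw [CFC.rpow_rpow_of_exponent_nonneg A p (1 / 2) hp.le (by norm_num), mul_one_div]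
  revert h1 hM hM2
  generalize A ^ p = M
  generalize hD : A ^ (p / 2) = D
  have hDsa : IsSelfAdjoint D := hD ▸ hsa A
  generalize hE : σ ^ (p / 2) = E
  have hEsa : IsSelfAdjoint E := hE ▸ hsa σ
  intro h1 hM hM2
  have h2 := tendsto_rpow_mul_cfc_mul hM (Real.rpow_nonneg hκ p) h1
    (γ := 1 / 2) (by norm_num) (by norm_num)
  rw [hM2] at h2
  have hG : ∀ δ : ℝ, IsSelfAdjoint (cfc (fun x => (x + δ) ^ (-(1 / 2 : ℝ))) M) :=
    fun δ => cfc_predicate _ _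
  revert h2 hG
  generalize (fun δ : ℝ => cfc (fun x => (x + δ) ^ (-(1 / 2 : ℝ))) M) = G
  intro h2 hG
  have h3 := h2.star.mul_const B
  rw [hEsa.star_eq] at h3
  refine h3.congr fun δ => ?_
  rw [star_mul, star_mul, hEsa.star_eq, hDsa.star_eq, (hG δ).star_eq, ← mul_assoc]

theorem star_mul_rpow_mul_le {A T : H →L[ℂ] H} (hT : 0 ≤ T) {p β δ : ℝ} (hβ : 0 < β)
    (hδ : 0 < δ) :
    star (cfc (fun x => (x + δ) ^ (-(1 / 2 : ℝ))) (A ^ p) * T ^ β) * A ^ p *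
      (cfc (fun x => (x + δ) ^ (-(1 / 2 : ℝ))) (A ^ p) * T ^ β) ≤ T ^ (2 * β) := by
  have hTsa : IsSelfAdjoint (T ^ β) := IsSelfAdjoint.of_nonneg CFC.rpow_nonneg
  have h1 := conj_cfc_add_rpow_le (M := A ^ p) CFC.rpow_nonneg hδ (γ := 1 / 2) (by norm_num)
    (by norm_num)
  rw [show (1 : ℝ) - 2 * (1 / 2) = 0 by norm_num, CFC.rpow_zero _ CFC.rpow_nonneg] at h1
  have hG : IsSelfAdjoint (cfc (fun x => (x + δ) ^ (-(1 / 2 : ℝ))) (A ^ p)) := cfc_predicate _ _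
  revert h1 hG
  generalize cfc (fun x => (x + δ) ^ (-(1 / 2 : ℝ))) (A ^ p) = G
  intro h1 hG
  have h2 := hTsa.conjugate_le_conjugate h1
  rw [mul_one, rpow_mul_rpow hT hβ hβ, ← two_mul] at h2
  refine le_trans (le_of_eq ?_) h2
  rw [star_mul, hG.star_eq, hTsa.star_eq]
  simp only [mul_assoc]

theorem mul_mul_star_le_rpow {S R T : H →L[ℂ] H} (hS : IsSelfAdjoint S) (hT : T = S * R * S)
    (hT0 : 0 ≤ T) {γ η : ℝ} (hγ : 0 < γ) (hγ1 : 2 * γ ≤ 1) (hη : 0 < η) :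
    cfc (fun x => (x + η) ^ (-γ)) T * S * R * star (cfc (fun x => (x + η) ^ (-γ)) T * S) ≤
      T ^ (1 - 2 * γ) := by
  have h1 := conj_cfc_add_rpow_le hT0 hη hγ hγ1
  have hL : IsSelfAdjoint (cfc (fun x => (x + η) ^ (-γ)) T) := cfc_predicate _ _
  revert h1 hL
  generalize cfc (fun x => (x + η) ^ (-γ)) T = L
  intro h1 hL
  refine le_trans (le_of_eq ?_) h1
  rw [star_mul, hL.star_eq, hS.star_eq, hT]
  simp only [mul_assoc]

/-- The singular values of `σ ^ s ρ ^ (1 / 2)` are the square roots of the eigenvalues of the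
sandwiched operator. -/
theorem exists_sandwichedTrace_eq_tsum {ρ σ : H →L[ℂ] H} (hρ : 0 ≤ ρ) (hfin : trace ρ ≠ ⊤)
    {α s : ℝ} (hα : 0 < α) (hs : (1 - α) / (2 * α) = s) :
    ∃ (κ : Type u) (h e : κ → H), Orthonormal ℂ h ∧ Orthonormal ℂ e ∧
      sandwichedTrace α ρ σ = ∑' k, ENNReal.ofReal
        ((‖inner ℂ (h k) ((σ ^ s * CFC.sqrt ρ) (e k))‖ ^ 2) ^ α) := by
  have hsa : IsSelfAdjoint (σ ^ s) := IsSelfAdjoint.of_nonneg CFC.rpow_nonneg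
  have h1 := sqrt_conj_eq hρ hsa
  have h2 := exists_singular_vectors (B := σ ^ s * CFC.sqrt ρ)
    (h1 ▸ trace_sandwich_ne_top hρ hfin hsa) hα
  rw [h1] at h2
  rwa [sandwichedTrace, hs]

/-- The estimate `sum_add_sum_le_trace` in the limit in which the approximate identity `N K`
becomes exact. -/
theorem sum_add_sum_le_trace_sandwich {ρ₁ ρ₂ σ₁ σ₂ A R T : H →L[ℂ] H} (hρ₁ : 0 ≤ ρ₁)
    (hρ₂ : 0 ≤ ρ₂) (hσ₁ : 0 ≤ σ₁) (hσ₂ : 0 ≤ σ₂) {a c : ℝ} (ha : 0 < a) (hc : 0 < c)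
    (hA : A = a • σ₁ + c • σ₂) (hR : R = a • ρ₁ + c • ρ₂) {α p : ℝ} (hα : 1 / 2 ≤ α) (hα1 : α < 1)
    (hp : p = (1 - α) / α) (hT : T = A ^ (p / 2) * R * A ^ (p / 2))
    {κ₁ κ₂ : Type*} {h₁ e₁ : κ₁ → H} {h₂ e₂ : κ₂ → H} (hh₁ : Orthonormal ℂ h₁)
    (he₁ : Orthonormal ℂ e₁) (hh₂ : Orthonormal ℂ h₂) (he₂ : Orthonormal ℂ e₂)
    (s₁ : Finset κ₁) (s₂ : Finset κ₂) :
    ENNReal.ofReal a * ∑ k ∈ s₁, ENNReal.ofReal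
        ((‖inner ℂ (h₁ k) ((σ₁ ^ (p / 2) * CFC.sqrt ρ₁) (e₁ k))‖ ^ 2) ^ α) +
      ENNReal.ofReal c * ∑ k ∈ s₂, ENNReal.ofReal
        ((‖inner ℂ (h₂ k) ((σ₂ ^ (p / 2) * CFC.sqrt ρ₂) (e₂ k))‖ ^ 2) ^ α) ≤ trace (T ^ α) := by
  have hα0 : 0 < α := by linarith
  have hp0 : 0 < p := by
    rw [hp]
    exact div_pos (by linarith) hα0
  have hp1 : p ≤ 1 := by rw [hp, div_le_one hα0]; linarith
  have hA0 : 0 ≤ A := hA ▸ nonneg_linear hσ₁ hσ₂ ha.le hc.le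
  have hR0 : 0 ≤ R := hR ▸ nonneg_linear hρ₁ hρ₂ ha.le hc.le
  have hsa : IsSelfAdjoint (A ^ (p / 2)) := IsSelfAdjoint.of_nonneg CFC.rpow_nonneg
  have hT0 : 0 ≤ T := hT ▸ hsa.conjugate_nonneg hR0
  have hβ : 0 < (1 - α) / 2 := by linarith
  have hβ1 : (1 - α) / 2 ≤ 1 := by linarith
  have hle₁ : ∀ {x y z : H →L[ℂ] H}, 0 ≤ y → z = a • x + c • y → x ≤ a⁻¹ • z := by
    rintro x y z hy rfl
    rw [smul_add, smul_smul, inv_mul_cancel₀ ha.ne', one_smul]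
    exact le_add_of_nonneg_right (smul_nonneg (by positivity) (smul_nonneg hc.le hy))
  have hle₂ : ∀ {x y z : H →L[ℂ] H}, 0 ≤ x → z = a • x + c • y → y ≤ c⁻¹ • z := by
    rintro x y z hx rfl
    rw [smul_add, smul_smul c⁻¹ c, inv_mul_cancel₀ hc.ne', one_smul]
    exact le_add_of_nonneg_left (smul_nonneg (by positivity) (smul_nonneg ha.le hx))
  have hlim₁ := fun V => tendsto_sandwich_sqrt (V := V) hR0 hρ₁ hsa hT (inv_nonneg.2 ha.le)
    (hle₁ hρ₂ hR) hβ hβ1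
  have hlim₂ := fun V => tendsto_sandwich_sqrt (V := V) hR0 hρ₂ hsa hT (inv_nonneg.2 hc.le)
    (hle₂ hρ₁ hR) hβ hβ1
  have hlim₁' := tendsto_rpow_half_mul (B := CFC.sqrt ρ₁) hA0 hσ₁ (inv_nonneg.2 ha.le)
    (hle₁ hσ₂ hA) hp0 hp1
  have hlim₂' := tendsto_rpow_half_mul (B := CFC.sqrt ρ₂) hA0 hσ₂ (inv_nonneg.2 hc.le)
    (hle₂ hσ₁ hA) hp0 hp1
  have hc₁ := (ENNReal.continuous_const_mul (a := ENNReal.ofReal a) ENNReal.ofReal_ne_top).comp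
    (continuous_sum_norm_inner_rpow h₁ e₁ s₁ hα0.le)
  have hc₂ := (ENNReal.continuous_const_mul (a := ENNReal.ofReal c) ENNReal.ofReal_ne_top).comp
    (continuous_sum_norm_inner_rpow h₂ e₂ s₂ hα0.le)
  refine le_of_tendsto ((hc₁.continuousAt.tendsto.comp hlim₁').add
    (hc₂.continuousAt.tendsto.comp hlim₂')) ?_
  filter_upwards [self_mem_nhdsWithin] with δ hδ
  refine le_of_tendsto ((hc₁.continuousAt.tendsto.comp (hlim₁ _)).add
    (hc₂.continuousAt.tendsto.comp (hlim₂ _))) ?_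
  filter_upwards [self_mem_nhdsWithin] with η hη
  have hN := star_mul_rpow_mul_le (A := A) (p := p) hT0 hβ hδ
  have hK := mul_mul_star_le_rpow hsa hT hT0 hβ (by linarith) hη
  rw [mul_div_cancel₀ _ two_ne_zero] at hN
  rw [mul_div_cancel₀ _ two_ne_zero, sub_sub_cancel] at hK
  have h := sum_add_sum_le_trace (N := cfc (fun x => (x + δ) ^ (-(1 / 2 : ℝ))) (A ^ p) *
    T ^ ((1 - α) / 2)) (K := cfc (fun x => (x + η) ^ (-((1 - α) / 2))) T * A ^ (p / 2))
    hρ₁ hρ₂ hσ₁ hσ₂ ha.le hc.le hα hα1 hp hT0 (by rw [← hA]; exact hN) (by rw [← hR]; exact hK)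
    hh₁ he₁ hh₂ he₂ s₁ s₂
  simp only [← mul_assoc] at h
  simpa only [Function.comp, ← mul_assoc] using h

/-- The sandwiched trace is jointly concave. -/
theorem sandwichedTrace_concave {ρ₁ ρ₂ σ₁ σ₂ : H →L[ℂ] H} (hρ₁ : 0 ≤ ρ₁) (hρ₂ : 0 ≤ ρ₂)
    (hσ₁ : 0 ≤ σ₁) (hσ₂ : 0 ≤ σ₂) (hfin₁ : trace ρ₁ ≠ ⊤) (hfin₂ : trace ρ₂ ≠ ⊤) {a c : ℝ}
    (ha : 0 < a) (hc : 0 < c) {α : ℝ} (hα : 1 / 2 ≤ α) (hα1 : α < 1) :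
    ENNReal.ofReal a * sandwichedTrace α ρ₁ σ₁ + ENNReal.ofReal c * sandwichedTrace α ρ₂ σ₂ ≤
      sandwichedTrace α (a • ρ₁ + c • ρ₂) (a • σ₁ + c • σ₂) := by
  have hα0 : 0 < α := by linarith
  have hp : (1 - α) / (2 * α) = (1 - α) / α / 2 := by field_simp
  obtain ⟨κ₁, h₁, e₁, hh₁, he₁, htr₁⟩ := exists_sandwichedTrace_eq_tsum (σ := σ₁) hρ₁ hfin₁ hα0 hp
  obtain ⟨κ₂, h₂, e₂, hh₂, he₂, htr₂⟩ := exists_sandwichedTrace_eq_tsum (σ := σ₂) hρ₂ hfin₂ hα0 hp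
  rw [htr₁, htr₂, ENNReal.tsum_eq_iSup_sum, ENNReal.tsum_eq_iSup_sum, ENNReal.mul_iSup,
    ENNReal.mul_iSup, sandwichedTrace, hp]
  exact ENNReal.iSup_add_iSup_le fun s₁ s₂ => sum_add_sum_le_trace_sandwich hρ₁ hρ₂ hσ₁ hσ₂ ha hc
    rfl rfl hα hα1 rfl rfl hh₁ he₁ hh₂ he₂ s₁ s₂

end

/-! ### Relative entropy in eigenbases -/

section

variable {H : Type u} [NormedAddCommGroup H] [InnerProductSpace ℂ H]

/-- `∑ᵢⱼ c (λᵢ, μⱼ) |⟨eᵢ, fⱼ⟩| ^ 2`, for bases `e` and `f` with attached eigenvalues `λ` and `μ`. -/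
noncomputable def spectralSum {ι κ : Type*} (c : ℝ≥0 → ℝ≥0 → ℝ≥0∞) (e : HilbertBasis ι ℂ H)
    (z : ι → ℝ≥0) (f : HilbertBasis κ ℂ H) (y : κ → ℝ≥0) : ℝ≥0∞ :=
  ∑' i, ∑' j, c (z i) (y j) * ENNReal.ofReal (‖inner ℂ (e i) (f j)‖ ^ 2)

theorem spectralSum_add {ι κ : Type*} (c d : ℝ≥0 → ℝ≥0 → ℝ≥0∞) (e : HilbertBasis ι ℂ H)
    (z : ι → ℝ≥0) (f : HilbertBasis κ ℂ H) (y : κ → ℝ≥0) :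
    spectralSum (fun l m => c l m + d l m) e z f y =
      spectralSum c e z f y + spectralSum d e z f y := by
  simp only [spectralSum, add_mul, ENNReal.tsum_add]

theorem spectralSum_const_mul {ι κ : Type*} (k : ℝ≥0∞) (c : ℝ≥0 → ℝ≥0 → ℝ≥0∞)
    (e : HilbertBasis ι ℂ H) (z : ι → ℝ≥0) (f : HilbertBasis κ ℂ H) (y : κ → ℝ≥0) :
    spectralSum (fun l m => k * c l m) e z f y = k * spectralSum c e z f y := by
  simp only [spectralSum, mul_assoc, ENNReal.tsum_mul_left]

theorem spectralSum_mono {ι κ : Type*} {c d : ℝ≥0 → ℝ≥0 → ℝ≥0∞} (h : ∀ l m, c l m ≤ d l m)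
    (e : HilbertBasis ι ℂ H) (z : ι → ℝ≥0) (f : HilbertBasis κ ℂ H) (y : κ → ℝ≥0) :
    spectralSum c e z f y ≤ spectralSum d e z f y :=
  ENNReal.tsum_le_tsum fun _ => ENNReal.tsum_le_tsum fun _ => by gcongr; exact h _ _

variable [CompleteSpace H]

theorem eigenProj_apply_eigenvector {A : H →L[ℂ] H} (hA : 0 ≤ A) {x : H} {l : ℝ≥0}
    (h : A x = ((l : ℝ) : ℂ) • x) (m : ℝ≥0) : eigenProj A m x = if l = m then x else 0 := by
  rw [eigenProj]
  split_ifs with hlm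
  · subst hlm
    rw [Submodule.starProjection_eq_self_iff]
    simp [h]
  · rw [Submodule.starProjection_apply_eq_zero_iff, Submodule.mem_orthogonal]
    intro y hy
    have hy : A y = ((m : ℝ) : ℂ) • y := by simpa [sub_eq_zero] using hy
    have h1 := inner_apply_comm (IsSelfAdjoint.of_nonneg hA) y x
    rw [h, hy, inner_smul_left, inner_smul_right, Complex.conj_ofReal] at h1
    by_contra hne
    exact hlm (NNReal.eq (by exact_mod_cast (mul_right_cancel₀ hne h1).symm))

theorem isSelfAdjoint_eigenProj (A : H →L[ℂ] H) (m : ℝ≥0) : IsSelfAdjoint (eigenProj A m) :=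
  isSelfAdjoint_starProjection _

theorem eigenProj_mul_self (A : H →L[ℂ] H) (m : ℝ≥0) :
    eigenProj A m * eigenProj A m = eigenProj A m :=
  Submodule.isIdempotentElem_starProjection _

theorem overlap_eq_tsum {ι κ : Type*} {ρ σ : H →L[ℂ] H} (hρ : 0 ≤ ρ) (hσ : 0 ≤ σ)
    {e : HilbertBasis ι ℂ H} {z : ι → ℝ≥0} (he : IsEigenbasis ρ e z)
    {f : HilbertBasis κ ℂ H} {y : κ → ℝ≥0} (hf : IsEigenbasis σ f y) (l m : ℝ≥0) :
    overlap ρ σ l m = ∑' i, ∑' j, if z i = l then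
      if y j = m then ENNReal.ofReal (‖inner ℂ (e i) (f j)‖ ^ 2) else 0 else 0 := by
  have h1 : eigenProj ρ l * eigenProj σ m * eigenProj ρ l =
      star (eigenProj σ m * eigenProj ρ l) * (eigenProj σ m * eigenProj ρ l) := by
    rw [star_mul, (isSelfAdjoint_eigenProj σ m).star_eq, (isSelfAdjoint_eigenProj ρ l).star_eq,
      ← mul_assoc, mul_assoc _ (eigenProj σ m) (eigenProj σ m), eigenProj_mul_self]
  rw [overlap, h1, trace_star_mul_self e]
  refine tsum_congr fun i => ?_
  rw [mul_apply_eq_comp, eigenProj_apply_eigenvector hρ (he i)]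
  split_ifs with hi
  · rw [← tsum_ofReal_norm_sq f]
    refine tsum_congr fun j => ?_
    rw [← inner_star_apply, (isSelfAdjoint_eigenProj σ m).star_eq,
      eigenProj_apply_eigenvector hσ (hf j)]
    split_ifs
    · rw [norm_inner_symm]
    · simp
  · simp

/-- A series over the spectral decompositions can be computed in eigenbases. -/
theorem tsum_mul_overlap {ι κ : Type*} {ρ σ : H →L[ℂ] H} (hρ : 0 ≤ ρ) (hσ : 0 ≤ σ)
    {e : HilbertBasis ι ℂ H} {z : ι → ℝ≥0} (he : IsEigenbasis ρ e z)
    {f : HilbertBasis κ ℂ H} {y : κ → ℝ≥0} (hf : IsEigenbasis σ f y) (c : ℝ≥0 → ℝ≥0 → ℝ≥0∞) :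
    ∑' l, ∑' m, c l m * overlap ρ σ l m = spectralSum c e z f y := by
  simp only [overlap_eq_tsum hρ hσ he hf, ← ENNReal.tsum_mul_left, spectralSum]
  calc _ = ∑' l, ∑' i, ∑' m, ∑' j, c l m * (if z i = l then
      if y j = m then ENNReal.ofReal (‖inner ℂ (e i) (f j)‖ ^ 2) else 0 else 0) :=
        tsum_congr fun l => ENNReal.tsum_comm
    _ = ∑' i, ∑' l, ∑' j, ∑' m, c l m * (if z i = l then
      if y j = m then ENNReal.ofReal (‖inner ℂ (e i) (f j)‖ ^ 2) else 0 else 0) := by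
        rw [ENNReal.tsum_comm]
        exact tsum_congr fun i => tsum_congr fun l => ENNReal.tsum_comm
    _ = ∑' i, ∑' j, ∑' l, ∑' m, c l m * (if z i = l then
      if y j = m then ENNReal.ofReal (‖inner ℂ (e i) (f j)‖ ^ 2) else 0 else 0) :=
        tsum_congr fun i => ENNReal.tsum_comm
    _ = _ := by
        refine tsum_congr fun i => tsum_congr fun j => ?_
        rw [tsum_eq_single (z i) fun l hl => by simp [hl.symm],
          tsum_eq_single (y j) fun m hm => by simp [hm.symm]]
        simp

theorem spectralSum_fst {ι κ : Type*} {ρ : H →L[ℂ] H} (hρ : 0 ≤ ρ) {e : HilbertBasis ι ℂ H}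
    {z : ι → ℝ≥0} (he : IsEigenbasis ρ e z) (f : HilbertBasis κ ℂ H) (y : κ → ℝ≥0) :
    spectralSum (fun l _ => (l : ℝ≥0∞)) e z f y = trace ρ := by
  rw [he.trace_eq hρ, spectralSum]
  refine tsum_congr fun i => ?_
  simp_rw [norm_inner_symm (e i)]
  rw [ENNReal.tsum_mul_left, tsum_ofReal_norm_sq f, e.orthonormal.1]
  simp

theorem spectralSum_snd {ι κ : Type*} {σ : H →L[ℂ] H} (hσ : 0 ≤ σ) (e : HilbertBasis ι ℂ H)
    (z : ι → ℝ≥0) {f : HilbertBasis κ ℂ H} {y : κ → ℝ≥0} (hf : IsEigenbasis σ f y) :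
    spectralSum (fun _ m => (m : ℝ≥0∞)) e z f y = trace σ := by
  rw [hf.trace_eq hσ, spectralSum, ENNReal.tsum_comm]
  refine tsum_congr fun j => ?_
  rw [ENNReal.tsum_mul_left, tsum_ofReal_norm_sq e, f.orthonormal.1]
  simp

theorem IsEigenbasis.ofReal_quad_rpow {κ : Type*} {σ : H →L[ℂ] H} (hσ : 0 ≤ σ)
    {f : HilbertBasis κ ℂ H} {y : κ → ℝ≥0} (hf : IsEigenbasis σ f y) {p : ℝ} (hp : 0 < p) (x : H) :
    ENNReal.ofReal (quad (σ ^ p) x) =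
      ∑' j, ENNReal.ofReal ((y j : ℝ) ^ p) * ENNReal.ofReal (‖inner ℂ x (f j)‖ ^ 2) := by
  have hs : IsSelfAdjoint (σ ^ (p / 2)) := IsSelfAdjoint.of_nonneg CFC.rpow_nonneg
  have h1 : σ ^ p = star (σ ^ (p / 2)) * σ ^ (p / 2) := by
    rw [hs.star_eq, rpow_mul_rpow hσ (by linarith) (by linarith), add_halves]
  rw [h1, quad_star_mul_self, ← tsum_ofReal_norm_sq f]
  refine tsum_congr fun j => ?_
  rw [← inner_star_apply, hs.star_eq, rpow_apply_eigenvector hσ (by linarith) (hf j),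
    inner_smul_left, norm_mul, mul_pow, Complex.conj_ofReal, Complex.norm_real,
    norm_inner_symm, ← ENNReal.ofReal_mul (by positivity)]
  congr 2
  rw [Real.norm_eq_abs, sq_abs, ← Real.rpow_natCast, ← Real.rpow_mul (NNReal.coe_nonneg _)]
  congr 1
  push_cast
  ring

theorem liebTrace_eq_spectralSum {ι κ : Type*} {σ : H →L[ℂ] H} (hσ : 0 ≤ σ)
    (e : HilbertBasis ι ℂ H) (z : ι → ℝ≥0) {f : HilbertBasis κ ℂ H} {y : κ → ℝ≥0}
    (hf : IsEigenbasis σ f y) {p : ℝ} (hp : 0 < p) :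
    liebTrace p 1 σ e z =
      spectralSum (fun l m => ENNReal.ofReal ((l : ℝ) ^ (1 - p) * (m : ℝ) ^ p)) e z f y := by
  refine tsum_congr fun i => ?_
  rw [one_apply_eq_self, ENNReal.ofReal_mul (by positivity), hf.ofReal_quad_rpow hσ hp,
    ← ENNReal.tsum_mul_left]
  refine tsum_congr fun j => ?_
  beta_reduce
  rw [ENNReal.ofReal_mul (by positivity), mul_assoc]

/-- `l (log l - log m) + m - l`, with value `∞` for `l > 0 = m`. -/
noncomputable def relTerm (l m : ℝ≥0) : ℝ≥0∞ :=
  if m = 0 ∧ l ≠ 0 then ⊤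
  else ENNReal.ofReal (l * (Real.log l - Real.log m) + m - l)

/-- The difference quotient at `p` that tends to `relTerm l m` as `p` tends to `0`. -/
noncomputable def relQuotient (p : ℝ) (l m : ℝ≥0) : ℝ≥0∞ :=
  ENNReal.ofReal ((l - (l : ℝ) ^ (1 - p) * (m : ℝ) ^ p) / p + m - l)

theorem relQuotient_add {p : ℝ} (hp : 0 < p) (hp1 : p < 1) (l m : ℝ≥0) :
    relQuotient p l m + ENNReal.ofReal p⁻¹ * ENNReal.ofReal ((l : ℝ) ^ (1 - p) * (m : ℝ) ^ p) =
      ENNReal.ofReal (p⁻¹ - 1) * l + m := by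
  have hl : 0 ≤ (l : ℝ) := l.2
  have hm : 0 ≤ (m : ℝ) := m.2
  have hp' : 1 ≤ p⁻¹ := (one_le_inv₀ hp).2 hp1.le
  have young := Real.geom_mean_le_arith_mean2_weighted (by linarith : 0 ≤ 1 - p) hp.le hl hm
    (by ring)
  have hnonneg : 0 ≤ (l - (l : ℝ) ^ (1 - p) * (m : ℝ) ^ p) / p + m - l := by
    have : (l - (l : ℝ) ^ (1 - p) * (m : ℝ) ^ p) / p + m - l =
      ((1 - p) * l + p * m - (l : ℝ) ^ (1 - p) * (m : ℝ) ^ p) / p := by field_simp; ring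
    rw [this]
    exact div_nonneg (by linarith) hp.le
  rw [← ENNReal.ofReal_coe_nnreal (p := l), ← ENNReal.ofReal_coe_nnreal (p := m), relQuotient,
    ← ENNReal.ofReal_mul (by positivity), ← ENNReal.ofReal_mul (by linarith),
    ← ENNReal.ofReal_add hnonneg (by positivity),
    ← ENNReal.ofReal_add (mul_nonneg (by linarith) hl) hm]
  congr 1
  field_simp
  ring

/-- This is the inequality `exp x ≥ 1 + x` for `x = p (log m - log l)`. -/
theorem relQuotient_le {p : ℝ} (hp : 0 < p) (hp1 : p < 1) (l m : ℝ≥0) :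
    relQuotient p l m ≤ relTerm l m := by
  rw [relTerm]
  split_ifs with h
  · exact le_top
  refine ENNReal.ofReal_le_ofReal ?_
  rcases eq_or_ne l 0 with rfl | hl
  · simp [Real.zero_rpow (by linarith : 1 - p ≠ 0)]
  have hm : m ≠ 0 := fun hm => h ⟨hm, hl⟩
  have hl : 0 < (l : ℝ) := by positivity
  have hm : 0 < (m : ℝ) := by positivity
  have h1 : (l : ℝ) ^ (1 - p) * (m : ℝ) ^ p =
      l * Real.exp (p * (Real.log m - Real.log l)) := by
    rw [Real.rpow_sub hl, Real.rpow_one, Real.rpow_def_of_pos hl, Real.rpow_def_of_pos hm,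
      div_mul_eq_mul_div, mul_div_assoc, ← Real.exp_sub]
    ring_nf
  have h2 := Real.add_one_le_exp (p * (Real.log m - Real.log l))
  have h3 : (l - (l : ℝ) ^ (1 - p) * (m : ℝ) ^ p) / p ≤ l * (Real.log l - Real.log m) := by
    rw [div_le_iff₀ hp, h1]
    nlinarith
  linarith

theorem tendsto_relQuotient (l m : ℝ≥0) :
    Filter.Tendsto (fun p => relQuotient p l m) (nhdsWithin 0 (Set.Ioi 0))
      (nhds (relTerm l m)) := by
  rw [relTerm]
  split_ifs with h
  · obtain ⟨rfl, hl⟩ := h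
    have hl : 0 < (l : ℝ) := by positivity
    refine ENNReal.tendsto_ofReal_atTop.comp ?_
    have h1 : Filter.Tendsto (fun p : ℝ => (l : ℝ) * p⁻¹ - l) (nhdsWithin 0 (Set.Ioi 0))
        Filter.atTop :=
      Filter.tendsto_atTop_add_const_right _ _ (tendsto_inv_nhdsGT_zero.const_mul_atTop hl)
    refine h1.congr' ?_
    filter_upwards [self_mem_nhdsWithin] with p hp
    simp [Real.zero_rpow (ne_of_gt hp), div_eq_mul_inv]
  refine (ENNReal.continuous_ofReal.tendsto _).comp ?_
  rcases eq_or_ne l 0 with rfl | hl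
  · refine tendsto_const_nhds.congr' ?_
    have : ∀ᶠ p : ℝ in nhdsWithin 0 (Set.Ioi 0), p < 1 :=
      nhdsWithin_le_nhds (gt_mem_nhds one_pos)
    filter_upwards [this] with p hp
    simp [Real.zero_rpow (by linarith : 1 - p ≠ 0)]
  have hm : m ≠ 0 := fun hm => h ⟨hm, hl⟩
  have hl : 0 < (l : ℝ) := by positivity
  have hm : 0 < (m : ℝ) := by positivity
  have h1 : ∀ p : ℝ, (l : ℝ) ^ (1 - p) * (m : ℝ) ^ p =
      l * Real.exp (p * (Real.log m - Real.log l)) := by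
    intro p
    rw [Real.rpow_sub hl, Real.rpow_one, Real.rpow_def_of_pos hl, Real.rpow_def_of_pos hm,
      div_mul_eq_mul_div, mul_div_assoc, ← Real.exp_sub]
    ring_nf
  have h2 : HasDerivAt (fun p : ℝ => -((l : ℝ) * Real.exp (p * (Real.log m - Real.log l))))
      (l * (Real.log l - Real.log m)) 0 := by
    have h3 := (((hasDerivAt_id (0 : ℝ)).mul_const (Real.log m - Real.log l)).exp.const_mul
      (l : ℝ)).neg
    refine h3.congr_deriv ?_
    simp only [id_eq, zero_mul, Real.exp_zero]
    ring
  have h3 := (hasDerivAt_iff_tendsto_slope_zero.1 h2).mono_left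
    (nhdsWithin_mono 0 fun p (hp : 0 < p) => ne_of_gt hp)
  refine ((h3.add_const (m : ℝ)).sub_const (l : ℝ)).congr fun p => ?_
  rw [h1]
  simp [div_eq_inv_mul]
  left
  ring

theorem toENNReal_logTerm_add (l m : ℝ≥0) :
    (logTerm l m).toENNReal + m = relTerm l m + (-logTerm l m).toENNReal + l ∧
      (-logTerm l m).toENNReal ≤ m := by
  rcases eq_or_ne l 0 with rfl | hl
  · simp [logTerm, relTerm]
  rcases eq_or_ne m 0 with rfl | hm
  · have h1 : logTerm l 0 = ⊤ := by
      rw [logTerm, ENNReal.coe_zero, ENNReal.log_zero, sub_eq_add_neg, EReal.neg_bot,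
        EReal.add_top_of_ne_bot, EReal.mul_top_of_pos]
      · exact_mod_cast pos_iff_ne_zero.2 hl
      · simpa using hl
    simp [h1, relTerm, hl]
  have hl0 : 0 < (l : ℝ) := by positivity
  have hm0 : 0 < (m : ℝ) := by positivity
  have h1 : logTerm l m = (((l : ℝ) * (Real.log l - Real.log m) : ℝ) : EReal) := by
    rw [logTerm, ENNReal.log_pos_real (by simpa using hl) (by simp),
      ENNReal.log_pos_real (by simpa using hm) (by simp)]
    simp
    rfl
  have h2 : (m : ℝ) - l - l * (Real.log m - Real.log l) ≥ 0 := by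
    have h3 := Real.log_le_sub_one_of_pos (div_pos hm0 hl0)
    rw [Real.log_div hm0.ne' hl0.ne'] at h3
    have h4 := mul_le_mul_of_nonneg_left h3 hl0.le
    have h5 : (l : ℝ) * (m / l - 1) = m - l := by field_simp
    linarith
  rw [h1, ← EReal.coe_neg, EReal.toENNReal_of_ne_top (EReal.coe_ne_top _),
    EReal.toENNReal_of_ne_top (EReal.coe_ne_top _), EReal.toReal_coe, EReal.toReal_coe,
    relTerm, if_neg (fun h => hm h.1), ← ENNReal.ofReal_coe_nnreal (p := l),
    ← ENNReal.ofReal_coe_nnreal (p := m)]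
  generalize hr : (l : ℝ) * (Real.log l - Real.log m) = r
  have h3 : 0 ≤ r + m - l := by rw [← hr]; linarith
  refine ⟨?_, ENNReal.ofReal_le_ofReal (by linarith)⟩
  rcases le_total 0 r with h | h
  · rw [ENNReal.ofReal_of_nonpos (p := -r) (by linarith), add_zero, ← ENNReal.ofReal_add h hm0.le,
      ← ENNReal.ofReal_add h3 hl0.le]
    ring_nf
  · rw [ENNReal.ofReal_of_nonpos h, zero_add, ← ENNReal.ofReal_add h3 (by linarith),
      ← ENNReal.ofReal_add (by linarith) hl0.le]
    ring_nf

/-- The relative entropy is the sum of the terms `relTerm`, up to the difference of the traces. As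
`relTerm` is non-negative, this replaces a difference of two series by a single one. -/
theorem umegaki_eq {ι κ : Type*} {ρ σ : H →L[ℂ] H} (hρ : 0 ≤ ρ) (hσ : 0 ≤ σ)
    (hρfin : trace ρ ≠ ⊤) (hσfin : trace σ ≠ ⊤)
    {e : HilbertBasis ι ℂ H} {z : ι → ℝ≥0} (he : IsEigenbasis ρ e z)
    {f : HilbertBasis κ ℂ H} {y : κ → ℝ≥0} (hf : IsEigenbasis σ f y) :
    umegaki ρ σ = (spectralSum relTerm e z f y : EReal) +
      (((trace ρ).toReal - (trace σ).toReal : ℝ) : EReal) := by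
  have h1 : spectralSum (fun l m => (logTerm l m).toENNReal) e z f y + trace σ =
      spectralSum relTerm e z f y + spectralSum (fun l m => (-logTerm l m).toENNReal) e z f y +
        trace ρ := by
    rw [← spectralSum_fst hρ he f y, ← spectralSum_snd hσ e z hf, ← spectralSum_add,
      ← spectralSum_add, ← spectralSum_add]
    simp only [(toENNReal_logTerm_add _ _).1]
  have h2 : spectralSum (fun l m => (-logTerm l m).toENNReal) e z f y ≠ ⊤ := by
    refine ne_top_of_le_ne_top hσfin ?_
    rw [← spectralSum_snd hσ e z hf]
    exact spectralSum_mono (fun l m => (toENNReal_logTerm_add l m).2) e z f y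
  rw [umegaki, tsum_mul_overlap hρ hσ he hf, tsum_mul_overlap hρ hσ he hf]
  revert h1 h2
  generalize spectralSum (fun l m => (logTerm l m).toENNReal) e z f y = P
  generalize spectralSum (fun l m => (-logTerm l m).toENNReal) e z f y = N
  generalize spectralSum relTerm e z f y = D
  intro h1 hN
  lift N to ℝ≥0 using hN
  generalize trace ρ = r at *
  generalize trace σ = s at *
  lift r to ℝ≥0 using hρfin
  lift s to ℝ≥0 using hσfin
  induction D with
  | top =>
    have : P = ⊤ := by simpa using h1
    subst this
    simp [sub_eq_add_neg]
  | coe D =>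
    have : P ≠ ⊤ := by
      rintro rfl
      simp at h1
      exact absurd h1.symm (by exact_mod_cast ENNReal.coe_ne_top)
    lift P to ℝ≥0 using this
    have h3 : (P : ℝ) + s = D + N + r := by exact_mod_cast h1
    have h4 : (P : ℝ) - N = D + (r - s) := by linarith
    have h5 : (((P : ℝ) - N : ℝ) : EReal) = ((D + (r - s) : ℝ) : EReal) := by rw [h4]
    simp only [EReal.coe_sub, EReal.coe_add] at h5 ⊢
    exact h5

/-- `∑ᵢⱼ relTerm (λᵢ, μⱼ) |⟨eᵢ, fⱼ⟩| ^ 2` is jointly convex in `(ρ, σ)`, as a limit of difference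
quotients of the functions of Lieb's theorem, which are affine at `p = 0`. -/
theorem spectralSum_relTerm_convex {ι ι₁ ι₂ κ κ₁ κ₂ : Type u} {ρ₁ ρ₂ σ₁ σ₂ : H →L[ℂ] H}
    (hρ₁ : 0 ≤ ρ₁) (hρ₂ : 0 ≤ ρ₂)
    (hσ₁ : 0 ≤ σ₁) (hσ₂ : 0 ≤ σ₂) {a c : ℝ} (ha : 0 ≤ a) (hc : 0 ≤ c)
    (hρfin₁ : trace ρ₁ ≠ ⊤) (hρfin₂ : trace ρ₂ ≠ ⊤)
    (hσfin₁ : trace σ₁ ≠ ⊤) (hσfin₂ : trace σ₂ ≠ ⊤)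
    {e₁ : HilbertBasis ι₁ ℂ H} {z₁ : ι₁ → ℝ≥0} (he₁ : IsEigenbasis ρ₁ e₁ z₁)
    {e₂ : HilbertBasis ι₂ ℂ H} {z₂ : ι₂ → ℝ≥0} (he₂ : IsEigenbasis ρ₂ e₂ z₂)
    {e : HilbertBasis ι ℂ H} {z : ι → ℝ≥0} (he : IsEigenbasis (a • ρ₁ + c • ρ₂) e z)
    {f₁ : HilbertBasis κ₁ ℂ H} {y₁ : κ₁ → ℝ≥0} (hf₁ : IsEigenbasis σ₁ f₁ y₁)
    {f₂ : HilbertBasis κ₂ ℂ H} {y₂ : κ₂ → ℝ≥0} (hf₂ : IsEigenbasis σ₂ f₂ y₂)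
    {f : HilbertBasis κ ℂ H} {y : κ → ℝ≥0} (hf : IsEigenbasis (a • σ₁ + c • σ₂) f y) :
    spectralSum relTerm e z f y ≤ ENNReal.ofReal a * spectralSum relTerm e₁ z₁ f₁ y₁ +
      ENNReal.ofReal c * spectralSum relTerm e₂ z₂ f₂ y₂ := by
  have hρ := nonneg_linear hρ₁ hρ₂ ha hc
  have hσ := nonneg_linear hσ₁ hσ₂ ha hc
  have hlin : ∀ {x y : ℝ≥0∞}, x ≠ ⊤ → y ≠ ⊤ →
      ENNReal.ofReal a * x + ENNReal.ofReal c * y ≠ ⊤ := fun hx hy =>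
    ENNReal.add_ne_top.2 ⟨ENNReal.mul_ne_top ENNReal.ofReal_ne_top hx,
      ENNReal.mul_ne_top ENNReal.ofReal_ne_top hy⟩
  -- the identity between the difference quotients and the functions of Lieb's theorem
  have hid : ∀ {p : ℝ}, 0 < p → p < 1 → ∀ {ι κ : Type u} {ρ σ : H →L[ℂ] H}
      {e : HilbertBasis ι ℂ H} {z : ι → ℝ≥0} {f : HilbertBasis κ ℂ H} {y : κ → ℝ≥0},
      0 ≤ ρ → 0 ≤ σ → IsEigenbasis ρ e z → IsEigenbasis σ f y →
      spectralSum (relQuotient p) e z f y + ENNReal.ofReal p⁻¹ * liebTrace p 1 σ e z =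
        ENNReal.ofReal (p⁻¹ - 1) * trace ρ + trace σ := by
    intro p hp hp1 ι κ ρ σ e z f y hρ hσ he hf
    rw [liebTrace_eq_spectralSum hσ e z hf hp, ← spectralSum_const_mul, ← spectralSum_add,
      ← spectralSum_fst hρ he f y, ← spectralSum_snd hσ e z hf, ← spectralSum_const_mul,
      ← spectralSum_add]
    simp only [relQuotient_add hp hp1]
  have hquot : ∀ {p : ℝ}, 0 < p → p < 1 → spectralSum (relQuotient p) e z f y ≤
      ENNReal.ofReal a * spectralSum relTerm e₁ z₁ f₁ y₁ +
        ENNReal.ofReal c * spectralSum relTerm e₂ z₂ f₂ y₂ := by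
    intro p hp hp1
    have h := hid hp hp1 hρ hσ he hf
    have h₁ := hid hp hp1 hρ₁ hσ₁ he₁ hf₁
    have h₂ := hid hp hp1 hρ₂ hσ₂ he₂ hf₂
    have hlieb := liebTrace_concave hσ₁ hσ₂ hρ₁ hρ₂ ha hc hρfin₁ hρfin₂ he₁ he₂ he hp hp1.le 1
    have hL : ENNReal.ofReal p⁻¹ * liebTrace p 1 (a • σ₁ + c • σ₂) e z ≠ ⊤ := by
      refine ne_top_of_le_ne_top ?_ (le_add_self.trans h.le)
      rw [trace_linear hρ₁ hρ₂ ha hc, trace_linear hσ₁ hσ₂ ha hc]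
      exact ENNReal.add_ne_top.2 ⟨ENNReal.mul_ne_top ENNReal.ofReal_ne_top (hlin hρfin₁ hρfin₂),
        hlin hσfin₁ hσfin₂⟩
    rw [trace_linear hρ₁ hρ₂ ha hc, trace_linear hσ₁ hσ₂ ha hc] at h
    have h3 : spectralSum (relQuotient p) e z f y ≤
        ENNReal.ofReal a * spectralSum (relQuotient p) e₁ z₁ f₁ y₁ +
          ENNReal.ofReal c * spectralSum (relQuotient p) e₂ z₂ f₂ y₂ := by
      refine (ENNReal.add_le_add_iff_right hL).1 ?_
      calc _ = ENNReal.ofReal a * (ENNReal.ofReal (p⁻¹ - 1) * trace ρ₁ + trace σ₁) +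
            ENNReal.ofReal c * (ENNReal.ofReal (p⁻¹ - 1) * trace ρ₂ + trace σ₂) := by
            rw [h]
            ring
        _ = ENNReal.ofReal a * spectralSum (relQuotient p) e₁ z₁ f₁ y₁ +
            ENNReal.ofReal c * spectralSum (relQuotient p) e₂ z₂ f₂ y₂ + ENNReal.ofReal p⁻¹ *
            (ENNReal.ofReal a * liebTrace p 1 σ₁ e₁ z₁ +
              ENNReal.ofReal c * liebTrace p 1 σ₂ e₂ z₂) := by
            rw [← h₁, ← h₂]
            ring
        _ ≤ _ := by gcongr
    refine h3.trans ?_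
    gcongr <;> exact spectralSum_mono (relQuotient_le hp hp1) _ _ _ _
  -- Fatou's lemma
  rw [spectralSum, ← ENNReal.tsum_prod, ENNReal.tsum_eq_iSup_sum]
  refine iSup_le fun s => ?_
  have hlim : Filter.Tendsto (fun p => ∑ i ∈ s, relQuotient p (z i.1) (y i.2) *
      ENNReal.ofReal (‖inner ℂ (e i.1) (f i.2)‖ ^ 2)) (nhdsWithin 0 (Set.Ioi 0))
      (nhds (∑ i ∈ s, relTerm (z i.1) (y i.2) *
        ENNReal.ofReal (‖inner ℂ (e i.1) (f i.2)‖ ^ 2))) :=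
    tendsto_finsetSum _ fun i _ => ENNReal.Tendsto.mul_const (tendsto_relQuotient _ _)
      (Or.inr ENNReal.ofReal_ne_top)
  refine le_of_tendsto hlim ?_
  have : ∀ᶠ p : ℝ in nhdsWithin 0 (Set.Ioi 0), p < 1 := nhdsWithin_le_nhds (gt_mem_nhds one_pos)
  filter_upwards [self_mem_nhdsWithin, this] with p hp hp1
  refine le_trans ?_ (hquot hp hp1)
  rw [spectralSum, ← ENNReal.tsum_prod]
  exact ENNReal.sum_le_tsum s

end

/-! ### Convexity of the divergences -/

section

variable {H : Type u} [NormedAddCommGroup H] [InnerProductSpace ℂ H] [CompleteSpace H]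

theorem umegaki_ne_bot_and_convex {ρ₁ ρ₂ σ₁ σ₂ : H →L[ℂ] H} (hρ₁ : 0 ≤ ρ₁) (hρ₂ : 0 ≤ ρ₂)
    (hσ₁ : 0 ≤ σ₁) (hσ₂ : 0 ≤ σ₂) {a c : ℝ} (ha : 0 < a) (hc : 0 < c)
    (hρfin₁ : trace ρ₁ ≠ ⊤) (hρfin₂ : trace ρ₂ ≠ ⊤)
    (hσfin₁ : trace σ₁ ≠ ⊤) (hσfin₂ : trace σ₂ ≠ ⊤) :
    umegaki ρ₁ σ₁ ≠ ⊥ ∧ umegaki ρ₂ σ₂ ≠ ⊥ ∧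
      umegaki (a • ρ₁ + c • ρ₂) (a • σ₁ + c • σ₂) ≤
        (a : EReal) * umegaki ρ₁ σ₁ + (c : EReal) * umegaki ρ₂ σ₂ := by
  have hρ := nonneg_linear hρ₁ hρ₂ ha.le hc.le
  have hσ := nonneg_linear hσ₁ hσ₂ ha.le hc.le
  have hlin : ∀ {x y : ℝ≥0∞}, x ≠ ⊤ → y ≠ ⊤ →
      ENNReal.ofReal a * x + ENNReal.ofReal c * y ≠ ⊤ := fun hx hy =>
    ENNReal.add_ne_top.2 ⟨ENNReal.mul_ne_top ENNReal.ofReal_ne_top hx,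
      ENNReal.mul_ne_top ENNReal.ofReal_ne_top hy⟩
  have htrρ := trace_linear hρ₁ hρ₂ ha.le hc.le
  have htrσ := trace_linear hσ₁ hσ₂ ha.le hc.le
  have hρfin : trace (a • ρ₁ + c • ρ₂) ≠ ⊤ := htrρ ▸ hlin hρfin₁ hρfin₂
  have hσfin : trace (a • σ₁ + c • σ₂) ≠ ⊤ := htrσ ▸ hlin hσfin₁ hσfin₂
  obtain ⟨ι₁, e₁, z₁, he₁⟩ := exists_eigenbasis hρ₁ hρfin₁
  obtain ⟨ι₂, e₂, z₂, he₂⟩ := exists_eigenbasis hρ₂ hρfin₂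
  obtain ⟨ι, e, z, he⟩ := exists_eigenbasis hρ hρfin
  obtain ⟨κ₁, f₁, y₁, hf₁⟩ := exists_eigenbasis hσ₁ hσfin₁
  obtain ⟨κ₂, f₂, y₂, hf₂⟩ := exists_eigenbasis hσ₂ hσfin₂
  obtain ⟨κ, f, y, hf⟩ := exists_eigenbasis hσ hσfin
  have hconv := spectralSum_relTerm_convex hρ₁ hρ₂ hσ₁ hσ₂ ha.le hc.le hρfin₁ hρfin₂ hσfin₁ hσfin₂
    he₁ he₂ he hf₁ hf₂ hf
  rw [umegaki_eq hρ₁ hσ₁ hρfin₁ hσfin₁ he₁ hf₁, umegaki_eq hρ₂ hσ₂ hρfin₂ hσfin₂ he₂ hf₂,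
    umegaki_eq hρ hσ hρfin hσfin he hf, htrρ, htrσ]
  revert hconv
  generalize spectralSum relTerm e z f y = D
  generalize spectralSum relTerm e₁ z₁ f₁ y₁ = D₁
  generalize spectralSum relTerm e₂ z₂ f₂ y₂ = D₂
  intro hconv
  have hreal : ∀ {x y : ℝ≥0∞}, x ≠ ⊤ → y ≠ ⊤ →
      (ENNReal.ofReal a * x + ENNReal.ofReal c * y).toReal = a * x.toReal + c * y.toReal := by
    intro x y hx hy
    rw [ENNReal.toReal_add (ENNReal.mul_ne_top ENNReal.ofReal_ne_top hx)
      (ENNReal.mul_ne_top ENNReal.ofReal_ne_top hy), ENNReal.toReal_mul, ENNReal.toReal_mul,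
      ENNReal.toReal_ofReal ha.le, ENNReal.toReal_ofReal hc.le]
  have hbot : ∀ (D : ℝ≥0∞) (r : ℝ), (D : EReal) + (r : EReal) ≠ ⊥ := by
    intro D r
    simp [EReal.add_eq_bot_iff]
  refine ⟨hbot _ _, hbot _ _, ?_⟩
  rw [hreal hρfin₁ hρfin₂, hreal hσfin₁ hσfin₂]
  have hbot' : ∀ {a : ℝ} (_ : 0 < a) (D : ℝ≥0∞) (r : ℝ),
      (a : EReal) * ((D : EReal) + (r : EReal)) ≠ ⊥ := by
    intro a ha D r h
    rw [EReal.mul_eq_bot] at h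
    simp only [hbot, and_false, EReal.coe_pos, ha.not_gt, EReal.coe_neg', false_and, or_false,
      EReal.coe_ne_bot, EReal.coe_ne_top] at h
  rcases eq_or_ne D₁ ⊤ with rfl | h₁
  · rw [EReal.coe_ennreal_top, EReal.top_add_coe, EReal.coe_mul_top_of_pos ha,
      EReal.top_add_of_ne_bot (hbot' hc _ _)]
    exact le_top
  rcases eq_or_ne D₂ ⊤ with rfl | h₂
  · rw [EReal.coe_ennreal_top, EReal.top_add_coe, EReal.coe_mul_top_of_pos hc,
      EReal.add_top_of_ne_bot (hbot' ha _ _)]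
    exact le_top
  have hD : D ≠ ⊤ := ne_top_of_le_ne_top (hlin h₁ h₂) hconv
  have h3 := ENNReal.toReal_mono (hlin h₁ h₂) hconv
  rw [hreal h₁ h₂] at h3
  rw [← EReal.coe_ennreal_toReal hD, ← EReal.coe_ennreal_toReal h₁, ← EReal.coe_ennreal_toReal h₂]
  norm_cast
  linarith

/-- Multiplication by a negative constant turns concavity of `x` into convexity of `log x`, also for
infinite values. -/
theorem mul_log_convex {x x₁ x₂ k : ℝ≥0∞} {a c g : ℝ} (ha : 0 < a) (hc : 0 < c) (hac : a + c = 1)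
    (hg : g < 0)
    (h : ENNReal.ofReal a * x₁ + ENNReal.ofReal c * x₂ ≤ x) :
    (g : EReal) * ENNReal.log (k * x) ≤
      (a : EReal) * ((g : EReal) * ENNReal.log (k * x₁)) +
        (c : EReal) * ((g : EReal) * ENNReal.log (k * x₂)) := by
  have h : ENNReal.ofReal a * (k * x₁) + ENNReal.ofReal c * (k * x₂) ≤ k * x := by
    refine le_trans (le_of_eq ?_) (mul_le_mul_right h k)
    ring
  revert h
  generalize k * x = x
  generalize k * x₁ = x₁
  generalize k * x₂ = x₂
  intro h
  have ha' : ENNReal.ofReal a ≠ 0 := by simpa using ha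
  have hc' : ENNReal.ofReal c ≠ 0 := by simpa using hc
  by_cases hx : x = ⊤
  · rw [hx, ENNReal.log_top, EReal.coe_mul_top_of_neg hg]
    exact bot_le
  have hx₁ : x₁ ≠ ⊤ := by
    rintro rfl
    rw [ENNReal.mul_top ha', top_add, top_le_iff] at h
    exact hx h
  have hx₂ : x₂ ≠ ⊤ := by
    rintro rfl
    rw [ENNReal.mul_top hc', add_top, top_le_iff] at h
    exact hx h
  have hlog : ∀ {x : ℝ≥0∞}, x ≠ ⊤ → (g : EReal) * ENNReal.log x = ⊤ ∨
      x ≠ 0 ∧ (g : EReal) * ENNReal.log x = ((g * Real.log x.toReal : ℝ) : EReal) := by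
    intro x hx
    rcases eq_or_ne x 0 with rfl | h0
    · left
      rw [ENNReal.log_zero, EReal.coe_mul_bot_of_neg hg]
    · right
      rw [ENNReal.log_pos_real h0 hx, EReal.coe_mul]
      exact ⟨h0, rfl⟩
  rcases hlog hx₁ with h₁ | ⟨h₁0, h₁⟩ <;> rcases hlog hx₂ with h₂ | ⟨h₂0, h₂⟩ <;> rw [h₁, h₂]
  · rw [EReal.coe_mul_top_of_pos ha, EReal.coe_mul_top_of_pos hc]
    exact le_top
  · rw [EReal.coe_mul_top_of_pos ha, ← EReal.coe_mul, EReal.top_add_coe]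
    exact le_top
  · rw [EReal.coe_mul_top_of_pos hc, ← EReal.coe_mul, EReal.coe_add_top]
    exact le_top
  have hp₁ := ENNReal.toReal_pos h₁0 hx₁
  have hp₂ := ENNReal.toReal_pos h₂0 hx₂
  have h3 := ENNReal.toReal_mono hx h
  rw [ENNReal.toReal_add (ENNReal.mul_ne_top ENNReal.ofReal_ne_top hx₁)
    (ENNReal.mul_ne_top ENNReal.ofReal_ne_top hx₂), ENNReal.toReal_mul, ENNReal.toReal_mul,
    ENNReal.toReal_ofReal ha.le, ENNReal.toReal_ofReal hc.le] at h3
  have h0 : x ≠ 0 := by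
    rintro rfl
    have : 0 < a * x₁.toReal + c * x₂.toReal := by positivity
    simp only [ENNReal.toReal_zero] at h3
    linarith
  have h4 := strictConcaveOn_log_Ioi.concaveOn.2 hp₁ hp₂ ha.le hc.le hac
  have h5 := h4.trans (Real.log_le_log (by simp only [smul_eq_mul]; positivity) h3)
  simp only [smul_eq_mul] at h5
  rw [ENNReal.log_pos_real h0 hx]
  norm_cast
  nlinarith

end

end RenyiDivergence

theorem theorem2 {H : Type*} [NormedAddCommGroup H] [InnerProductSpace ℂ H] [CompleteSpace H]
    (α : ℝ) (hα : 1 / 2 ≤ α) (hα' : α ≤ 1) (t : ℝ) (ht : 0 < t)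
    (ρ₁ ρ₂ σ₁ σ₂ : H →L[ℂ] H) (hρ₁ : 0 ≤ ρ₁) (hρ₂ : 0 ≤ ρ₂) (hσ₁ : 0 ≤ σ₁) (hσ₂ : 0 ≤ σ₂)
    (htr₁ : RenyiDivergence.trace ρ₁ = ENNReal.ofReal t)
    (htr₂ : RenyiDivergence.trace ρ₂ = ENNReal.ofReal t)
    (hfin₁ : α = 1 → RenyiDivergence.trace σ₁ < ⊤)
    (hfin₂ : α = 1 → RenyiDivergence.trace σ₂ < ⊤)
    (a b : ℝ) (ha : 0 ≤ a) (hb : 0 ≤ b) (hab : a + b = 1) :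
    RenyiDivergence.divergence α (a • ρ₁ + b • ρ₂) (a • σ₁ + b • σ₂) ≤
      (a : EReal) * RenyiDivergence.divergence α ρ₁ σ₁ +
        (b : EReal) * RenyiDivergence.divergence α ρ₂ σ₂ := by
  rcases ha.eq_or_lt with rfl | ha
  · rw [zero_add] at hab
    subst hab
    simp
  rcases hb.eq_or_lt with rfl | hb
  · rw [add_zero] at hab
    subst hab
    simp
  have htr : RenyiDivergence.trace (a • ρ₁ + b • ρ₂) = ENNReal.ofReal t := by
    rw [RenyiDivergence.trace_linear hρ₁ hρ₂ ha.le hb.le, htr₁, htr₂, ← add_mul,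
      ← ENNReal.ofReal_add ha.le hb.le, hab, ENNReal.ofReal_one, one_mul]
  have hρfin₁ : RenyiDivergence.trace ρ₁ ≠ ⊤ := htr₁ ▸ ENNReal.ofReal_ne_top
  have hρfin₂ : RenyiDivergence.trace ρ₂ ≠ ⊤ := htr₂ ▸ ENNReal.ofReal_ne_top
  rw [RenyiDivergence.divergence, RenyiDivergence.divergence, RenyiDivergence.divergence, htr,
    htr₁, htr₂]
  split_ifs with h1
  · obtain ⟨h₁, h₂, h⟩ := RenyiDivergence.umegaki_ne_bot_and_convex hρ₁ hρ₂ hσ₁ hσ₂ ha hb hρfin₁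
      hρfin₂ (hfin₁ h1).ne (hfin₂ h1).ne
    rw [← ENNReal.ofReal_inv_of_pos ht, EReal.coe_ennreal_ofReal,
      max_eq_left (inv_nonneg.2 ht.le), mul_left_comm, mul_left_comm (b : EReal),
      ← EReal.left_distrib_of_nonneg_of_ne_top (by exact_mod_cast inv_nonneg.2 ht.le)
        (EReal.coe_ne_top _)]
    exact mul_le_mul_of_nonneg_left h (by exact_mod_cast inv_nonneg.2 ht.le)
  · exact RenyiDivergence.mul_log_convex ha hb hab
      (inv_lt_zero.2 (sub_neg.2 (lt_of_le_of_ne hα' h1)))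
      (RenyiDivergence.sandwichedTrace_concave hρ₁ hρ₂ hσ₁ hσ₂ hρfin₁ hρfin₂ ha hb hα
        (lt_of_le_of_ne hα' h1))
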